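/- **Setting.** Let $\rho:\mathcal X\times\mathbb R^p\to\mathbb R$ be a loss which is twice differentiable in $\theta\in\mathbb R^p$, and write $\Psi(x,\theta)=\nabla_\theta\rho(x,\theta)$, $\dot\Psi(x,\theta)=\partial\Psi(x,\theta)/\partial\theta^\top$. For data $x_1,\dots,x_n\in\mathcal X$ ($n,p\ge 1$) let $\mathcal L_n(\theta)=\frac1n\sum_{i=1}^n\rho(x_i,\theta)$, and let $\hat\theta$ be a global minimizer of $\mathcal L_n$. Suppose that: * $\|\Psi(x,\theta)\|_2\le B$ for all $x,\theta$; * $\mathcal L_n$ is $C^3$ and $(\gamma,2)$-self-concordant with $\gamma>0$, i.e. $|\langle\nabla^3\mathcal L_n(\theta)[v]u,u\rangle|\le\gamma\,\big(u^\top\nabla^2\mathcal L_n(\theta)u\big)\,\|v\|_2$ for all $\theta,u,v\in\mathbb R^p$; * $\nabla^2\mathcal L_n$ is positive definite on some ball $\mathcal B_r(\theta^*)$, $r>0$, and for all $\theta$ it has the form $\nabla^2\mathcal L_n(\theta)=\frac1n\sum_{i=1}^n a(x_i,\theta)a(x_i,\theta)^\top$ with $a:\mathcal X\times\mathbb R^p\to\mathbb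 R^p$ and $\sup_{x,\theta}\|a(x,\theta)\|_2^2\le\bar B$. Let $K\ge1$, $\mu>0$, $\eta>0$, and let $\theta^{(0)}\in\mathbb R^p$ be fixed. For $0\le k<K$ the noisy damped Newton iterates are $$\theta^{(k+1)}=\theta^{(k)}-\eta H_k^{-1}\Big(\frac1n\sum_{i=1}^n\Psi(x_i,\theta^{(k)})+\frac{2B\sqrt{2K}}{\mu n}Z_k\Big),\qquad H_k=\frac1n\sum_{i=1}^n\dot\Psi(x_i,\theta^{(k)})+\frac{2\bar B\sqrt{2K}}{\mu n}W_k,$$ where the $Z_k$ are standard Gaussian vectors in $\mathbb R^p$, the $W_k$ are symmetric random $p\times p$ matrices whose upper-triangular entries (diagonal included) are i.i.d. $N(0,1)$, and all of these variables are independent. The data are fixed; the probability below is over the noise. **Statement.** Let $\Delta_0=\mathcal L_n(\theta^{(0)})-\mathcal L_n(\hat\theta)>0$, and let $R_0$ be $$R_0=\frac1\gamma\,g^{-1}\!\left(\frac{\gamma^2\Delta_0}{\lambda_{\min}(\nabla^2\mathcal L_n(\hat\theta))}\right),\qquad g(t)=e^{-t}+t-1\quad(t>0),$$ or any larger real number.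 Put $\tau_{1,R_0}=\inf_{\|\theta-\hat\theta\|_2\le R_0}\lambda_{\min}(\nabla^2\mathcal L_n(\theta))$. There are a constant $C'>0$ depending only on $\tau_{1,R_0},B,\bar B$ and a constant $c>0$ depending only on $\tau_{1,R_0},B,\bar B,\Delta_0$ such that, for every $\xi\in(0,1)$, if $$0<\eta\le\min\left\{\frac1{2\exp(2\gamma R_0)},\ \frac{4\tau_{1,R_0}^2}{\bar B^2}\right\}\qquad\text{and}\qquad n\ge c\,\frac{\sqrt{Kp\log(Kp/\xi)}}{\mu},$$ then with probability at least $1-\xi$ $$\mathcal L_n(\theta^{(K)})-\mathcal L_n(\hat\theta)\le\left(1-\frac{\eta}{\exp(2\gamma R_0)}\right)^K\big(\mathcal L_n(\theta^{(0)})-\mathcal L_n(\hat\theta)\big)+r_{priv},\qquad r_{priv}=C'\,\frac{\sqrt{Kp\log(Kp/\xi)}}{\mu n\,\tau_{1,R_0}^2}.$$ -/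

import Mathlib

open MeasureTheory ProbabilityTheory
open scoped Matrix

namespace NoisyNewton

/-- Parameter space `ℝ^p` with the Euclidean norm. -/
abbrev Vec (p : ℕ) : Type := EuclideanSpace ℝ (Fin p)

/-- Real `p × p` matrices. -/
abbrev Mat (p : ℕ) : Type := Matrix (Fin p) (Fin p) ℝ

noncomputable section

/-- The matrix-vector product `A v`, as an element of `ℝ^p`. -/
def mulV {p : ℕ} (A : Mat p) (v : Vec p) : Vec p :=
  WithLp.toLp 2 (A *ᵥ WithLp.ofLp v)

/-- `‖v‖_A² = vᵀ A v`. -/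
def normSqMat {p : ℕ} (A : Mat p) (v : Vec p) : ℝ :=
  WithLp.ofLp v ⬝ᵥ (A *ᵥ WithLp.ofLp v)

/-- `‖v‖_A = (vᵀ A v)^{1/2}`. -/
def normMat {p : ℕ} (A : Mat p) (v : Vec p) : ℝ :=
  Real.sqrt (normSqMat A v)

/-- The smallest eigenvalue of a symmetric real matrix. -/
def lamMin {p : ℕ} (A : Mat p) : ℝ :=
  sInf (spectrum ℝ A)

/-- The Jacobian matrix `∂F_i / ∂θ_j` of a vector field. -/
def jacobian {p : ℕ} (F : Vec p → Vec p) (θ : Vec p) : Mat p :=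
  Matrix.of fun i j => (fderiv ℝ F θ (EuclideanSpace.single j 1)) i

/-- The Hessian matrix, i.e. the Jacobian of the gradient. -/
def hess {p : ℕ} (f : Vec p → ℝ) (θ : Vec p) : Mat p :=
  jacobian (gradient f) θ

/-- Generalized `(γ, ν)`-self-concordance of a `C³` function on `ℝ^p`:
`|⟨∇³f(x)[v] u, u⟩| ≤ γ ‖u‖²_{∇²f(x)} ‖v‖_{∇²f(x)}^{ν-2} ‖v‖^{3-ν}`, where
`⟨∇³f(x)[v] u, u⟩` is the derivative of `y ↦ uᵀ ∇²f(y) u` at `x` in the direction `v`. -/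
structure SelfConcordant {p : ℕ} (γ ν : ℝ) (f : Vec p → ℝ) : Prop where
  contDiff : ContDiff ℝ 3 f
  bound : ∀ x u v : Vec p,
    |fderiv ℝ (fun y => normSqMat (hess f y) u) x v| ≤
      γ * normSqMat (hess f x) u * normMat (hess f x) v ^ (ν - 2) * ‖v‖ ^ (3 - ν)

/-- The empirical loss `L_n(θ) = (1/n) ∑ ρ(x_i, θ)`. -/
def empLoss {𝒳 : Type*} {n p : ℕ} (ρ : 𝒳 → Vec p → ℝ) (x : Fin n → 𝒳) (θ : Vec p) : ℝ :=
  (n : ℝ)⁻¹ * ∑ i, ρ (x i) θ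

/-- The score `Ψ(x, θ) = ∂ρ(x, θ)/∂θ`. -/
def score {𝒳 : Type*} {p : ℕ} (ρ : 𝒳 → Vec p → ℝ) (y : 𝒳) (θ : Vec p) : Vec p :=
  gradient (ρ y) θ

/-- `Ψ̇(x, θ) = ∂Ψ(x, θ)/∂θᵀ`. -/
def scoreDot {𝒳 : Type*} {p : ℕ} (ρ : 𝒳 → Vec p → ℝ) (y : 𝒳) (θ : Vec p) : Mat p :=
  jacobian (score ρ y) θ

/-- The Hessian condition: the Hessian of the empirical loss is positive definite on some ball
`B_r(θ⋆)`, and it is of the Gram form `(1/n) ∑ a(x_i, θ) a(x_i, θ)ᵀ` with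
`sup_{x, θ} ‖a(x, θ)‖² ≤ Bbar`. -/
structure HessianCondition {𝒳 : Type*} {n p : ℕ} (ρ : 𝒳 → Vec p → ℝ) (x : Fin n → 𝒳)
    (Bbar : ℝ) : Prop where
  posDef : ∃ (θstar : Vec p) (r : ℝ), 0 < r ∧
    ∀ θ ∈ Metric.ball θstar r, (hess (empLoss ρ x) θ).PosDef
  gram : ∃ a : 𝒳 → Vec p → Vec p,
    (∀ y θ, ‖a y θ‖ ^ 2 ≤ Bbar) ∧
    ∀ θ, hess (empLoss ρ x) θ =
      (n : ℝ)⁻¹ • ∑ i, Matrix.vecMulVec (WithLp.ofLp (a (x i) θ)) (WithLp.ofLp (a (x i) θ))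

/-- `τ_{1,r}`: the infimum of the smallest eigenvalue of the Hessian of `f` over the ball of
radius `r` around `θ`. -/
def tau1 {p : ℕ} (f : Vec p → ℝ) (θ : Vec p) (r : ℝ) : ℝ :=
  sInf ((fun θ' => lamMin (hess f θ')) '' Metric.closedBall θ r)

/-- `g(t) = e^{-t} + t - 1`. -/
def gFun (t : ℝ) : ℝ := Real.exp (-t) + t - 1

/-- The inverse of the bijection `g : (0, ∞) → (0, ∞)`. -/
def gInv : ℝ → ℝ := Function.invFunOn gFun (Set.Ioi 0)

/-- The scalar entries of the noise: the coordinates of the vectors `Z_k` and the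
upper-triangular entries (diagonal included) of the matrices `W_k`, for `k < K`. -/
def noiseEntry {Ω : Type*} {p : ℕ} (K : ℕ) (Z : ℕ → Ω → Vec p) (W : ℕ → Ω → Mat p) :
    (Fin K × Fin p) ⊕ (Fin K × {ij : Fin p × Fin p // ij.1 ≤ ij.2}) → Ω → ℝ
  | Sum.inl (k, i), ω => Z k ω i
  | Sum.inr (k, ij), ω => W k ω ij.1.1 ij.1.2

/-- The noise of the algorithm: `Z_k` are standard Gaussian vectors in `ℝ^p`, `W_k` are symmetric
matrices whose upper-triangular entries are standard normal, and everything is independent. -/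
structure IsNewtonNoise {Ω : Type*} [MeasurableSpace Ω] {p : ℕ} (P : Measure Ω) (K : ℕ)
    (Z : ℕ → Ω → Vec p) (W : ℕ → Ω → Mat p) : Prop where
  symm : ∀ k < K, ∀ ω, (W k ω).IsSymm
  law : ∀ e, HasLaw (noiseEntry K Z W e) (gaussianReal 0 1) P
  indep : iIndepFun (noiseEntry K Z W) P

/-- The noisy Hessian `H_k = (1/n) ∑ Ψ̇(x_i, θ) + (2 Bbar √(2K) / (μ n)) W_k`. -/
def noisyHess {𝒳 : Type*} {n p : ℕ} (ρ : 𝒳 → Vec p → ℝ) (x : Fin n → 𝒳) (Bbar μ : ℝ) (K : ℕ)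
    (Wk : Mat p) (θ : Vec p) : Mat p :=
  (n : ℝ)⁻¹ • (∑ i, scoreDot ρ (x i) θ) + (2 * Bbar * Real.sqrt (2 * K) / (μ * n)) • Wk

/-- The noisy gradient `(1/n) ∑ Ψ(x_i, θ) + (2 B √(2K) / (μ n)) Z_k`. -/
def noisyGrad {𝒳 : Type*} {n p : ℕ} (ρ : 𝒳 → Vec p → ℝ) (x : Fin n → 𝒳) (B μ : ℝ) (K : ℕ)
    (Zk : Vec p) (θ : Vec p) : Vec p :=
  (n : ℝ)⁻¹ • (∑ i, score ρ (x i) θ) + (2 * B * Real.sqrt (2 * K) / (μ * n)) • Zk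

/-- The noisy damped Newton iterates
`θ^{(k+1)} = θ^{(k)} - η H_k⁻¹ ((1/n) ∑ Ψ(x_i, θ^{(k)}) + (2 B √(2K) / (μ n)) Z_k)` for given
noise sequences `Z`, `W`. -/
def newtonIter {𝒳 : Type*} {n p : ℕ} (ρ : 𝒳 → Vec p → ℝ) (x : Fin n → 𝒳) (B Bbar μ η : ℝ)
    (K : ℕ) (θ0 : Vec p) (Z : ℕ → Vec p) (W : ℕ → Mat p) : ℕ → Vec p
  | 0 => θ0
  | k + 1 =>
    let θ := newtonIter ρ x B Bbar μ η K θ0 Z W k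
    θ - η • mulV (noisyHess ρ x Bbar μ K (W k) θ)⁻¹ (noisyGrad ρ x B μ K (Z k) θ)

/-- The rate `√(K p log(K p / ξ))`. -/
def rate (K p : ℕ) (ξ : ℝ) : ℝ :=
  Real.sqrt ((K : ℝ) * p * Real.log ((K : ℝ) * p / ξ))

end

end NoisyNewton

/-! For ν = 2, self-concordance makes Hessians at distance `d` comparable up to the factor `exp (γ
d)`. Integrating this twice from the minimizer shows that the initial sublevel set lies in the ball
of radius `R0`, where the Hessian is between `τ` and `Bbar`.

On the noise event a step uses a direction `w` with `(H + E) w = ∇f + e`, where `E` is at most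
`τ/32` in norm and `e` at most `ε`. Two estimates are played against each other: the optimality gap
is at most a multiple of `wᵀ H w` (`gap_le_of_noisy_solution`), and the step lowers the loss by a
multiple of `wᵀ H w` (`noisy_newton_decrease`), both up to `ε² / τ`. Hence the gap contracts by `1 -
η q` with `q = max (exp (-γ R)) (τ / b)`, and the iterates never leave the sublevel set
(`noisy_newton_step`). The first entry of `q` gives the contraction factor. The second bounds the
accumulated noise `ε² / (τ q)` by `ε² b / τ²`, which involves neither `γ` nor `R`. This is quadratic
in `r = rate / (μ n)`, and the sample size forces `r ≤ 1`, so it is linear as well.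

The noise event has probability at least `1 - ξ` (`IsNewtonNoise.noiseBounded_prob`): Gaussian tails
with a net for the matrices, and a small-ball bound when the logarithm is too small for a union
bound. -/

namespace NoisyNewton

/-! ### Quadratic forms and the smallest eigenvalue. -/

section Matrices

variable {p : ℕ}

theorem normSqMat_eq_inner (A : Mat p) (u : Vec p) : normSqMat A u = inner ℝ u (mulV A u) := by
  simp [normSqMat, mulV, PiLp.inner_apply, dotProduct, mul_comm]

theorem mulV_add_right (A : Mat p) (u v : Vec p) : mulV A (u + v) = mulV A u + mulV A v := by
  simp [mulV, Matrix.mulVec_add]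

theorem mulV_smul_right (A : Mat p) (c : ℝ) (u : Vec p) : mulV A (c • u) = c • mulV A u := by
  simp [mulV, Matrix.mulVec_smul]

theorem mulV_add_left (A A' : Mat p) (u : Vec p) : mulV (A + A') u = mulV A u + mulV A' u := by
  simp [mulV, Matrix.add_mulVec]

theorem mulV_smul_left (c : ℝ) (A : Mat p) (u : Vec p) : mulV (c • A) u = c • mulV A u := by
  simp [mulV, Matrix.smul_mulVec]

theorem inner_mulV_comm {A : Mat p} (hA : A.IsSymm) (u v : Vec p) :
    inner ℝ u (mulV A v) = inner ℝ v (mulV A u) := by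
  simp only [mulV, EuclideanSpace.inner_eq_star_dotProduct, star_trivial]
  rw [dotProduct_comm, Matrix.dotProduct_mulVec, ← Matrix.mulVec_transpose, hA.eq]

theorem normSqMat_smul (A : Mat p) (c : ℝ) (u : Vec p) :
    normSqMat A (c • u) = c ^ 2 * normSqMat A u := by
  simp only [normSqMat_eq_inner, mulV_smul_right, inner_smul_left, inner_smul_right]
  simp; ring

theorem normSqMat_add {A : Mat p} (hA : A.IsSymm) (u v : Vec p) :
    normSqMat A (u + v) = normSqMat A u + 2 * inner ℝ u (mulV A v) + normSqMat A v := by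
  simp only [normSqMat_eq_inner, mulV_add_right, inner_add_left, inner_add_right]
  rw [inner_mulV_comm hA v u]; ring

theorem normSqMat_sub_smul_one (A : Mat p) (m : ℝ) (u : Vec p) :
    normSqMat (A - algebraMap ℝ (Mat p) m) u = normSqMat A u - m * ‖u‖ ^ 2 := by
  rw [← real_inner_self_eq_norm_sq]
  simp only [normSqMat, Matrix.sub_mulVec, Algebra.algebraMap_eq_smul_one, Matrix.smul_mulVec,
    PiLp.inner_apply, dotProduct_sub, dotProduct_smul, Matrix.one_mulVec]
  simp [dotProduct, ← sq]

theorem isHermitian_of_isSymm {A : Mat p} (hA : A.IsSymm) : A.IsHermitian := by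
  rw [Matrix.IsHermitian, Matrix.conjTranspose_eq_transpose_of_trivial]; exact hA

theorem posSemidef_iff_normSqMat {A : Mat p} (hA : A.IsSymm) :
    A.PosSemidef ↔ ∀ u, 0 ≤ normSqMat A u := by
  rw [Matrix.posSemidef_iff_dotProduct_mulVec]
  refine ⟨fun h u => by simpa [normSqMat] using h.2 u.ofLp,
    fun h => ⟨isHermitian_of_isSymm hA, fun u => by simpa [normSqMat] using h (WithLp.toLp 2 u)⟩⟩

/-- Both sides say that `A - m` is positive semidefinite: shifting by `m` translates the spectrum
and subtracts `m ‖u‖²` from the form. -/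
theorem forall_le_spectrum_iff {A : Mat p} (hA : A.IsSymm) (m : ℝ) :
    (∀ l ∈ spectrum ℝ A, m ≤ l) ↔ ∀ u, m * ‖u‖ ^ 2 ≤ normSqMat A u := by
  have hB : (A - algebraMap ℝ (Mat p) m).IsSymm := by
    rw [Algebra.algebraMap_eq_smul_one]
    exact hA.sub (Matrix.isSymm_one.smul m)
  have h1 := posSemidef_iff_normSqMat hB
  rw [(isHermitian_of_isSymm hB).posSemidef_iff_eigenvalues_nonneg] at h1
  have h2 : (0 ≤ (isHermitian_of_isSymm hB).eigenvalues) ↔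
      ∀ l ∈ spectrum ℝ (A - algebraMap ℝ (Mat p) m), 0 ≤ l := by
    rw [(isHermitian_of_isSymm hB).spectrum_real_eq_range_eigenvalues]
    simp [Pi.le_def]
  rw [h2] at h1
  simp only [normSqMat_sub_smul_one, sub_nonneg] at h1
  rw [← h1, ← spectrum.sub_singleton_eq]
  simp

theorem spectrum_nonempty_of_isSymm (hp : 1 ≤ p) {A : Mat p} (hA : A.IsSymm) :
    (spectrum ℝ A).Nonempty := by
  have : Nonempty (Fin p) := ⟨⟨0, hp⟩⟩
  rw [(isHermitian_of_isSymm hA).spectrum_real_eq_range_eigenvalues]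
  exact Set.range_nonempty _

theorem lamMin_mul_le (A : Mat p) (hA : A.IsSymm) (u : Vec p) :
    lamMin A * ‖u‖ ^ 2 ≤ normSqMat A u := by
  refine (forall_le_spectrum_iff hA _).1 (fun l hl => csInf_le ?_ hl) u
  exact (Matrix.finite_real_spectrum).bddBelow

theorem le_lamMin (hp : 1 ≤ p) {A : Mat p} (hA : A.IsSymm) {m : ℝ}
    (h : ∀ u, m * ‖u‖ ^ 2 ≤ normSqMat A u) : m ≤ lamMin A :=
  le_csInf (spectrum_nonempty_of_isSymm hp hA) ((forall_le_spectrum_iff hA m).2 h)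

theorem lamMin_mem_spectrum (hp : 1 ≤ p) {A : Mat p} (hA : A.IsSymm) :
    lamMin A ∈ spectrum ℝ A :=
  (spectrum_nonempty_of_isSymm hp hA).csInf_mem (Matrix.finite_real_spectrum)

theorem lamMin_pos (hp : 1 ≤ p) {A : Mat p} (hA : A.IsSymm) (h : ∀ u, u ≠ 0 → 0 < normSqMat A u) :
    0 < lamMin A := by
  have hpd : A.PosDef := by
    rw [Matrix.posDef_iff_dotProduct_mulVec]
    refine ⟨isHermitian_of_isSymm hA, fun u hu => ?_⟩
    simpa [normSqMat] using h (WithLp.toLp 2 u) (by simpa using hu)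
  have hmem := lamMin_mem_spectrum hp hA
  rw [(isHermitian_of_isSymm hA).spectrum_real_eq_range_eigenvalues] at hmem
  obtain ⟨i, hi⟩ := hmem
  rw [← hi]
  exact hpd.eigenvalues_pos i

end Matrices

/-! ### Gradients, Hessians and second-order bounds along segments. -/

section Calculus

variable {p : ℕ} {f : Vec p → ℝ}

theorem mulV_jacobian (F : Vec p → Vec p) (θ u : Vec p) :
    mulV (jacobian F θ) u = fderiv ℝ F θ u := by
  have hu : u = ∑ j, u j • EuclideanSpace.single j (1 : ℝ) := by
    ext i; simp [Finset.sum_apply, Pi.single_apply]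
  conv_rhs => rw [hu, map_sum]
  ext i
  simp [mulV, jacobian, Matrix.mulVec, dotProduct, mul_comm]

theorem contDiff_gradient {n m : WithTop ℕ∞} (hf : ContDiff ℝ n f) (h : m + 1 ≤ n) :
    ContDiff ℝ m (gradient f) := by
  unfold gradient
  exact (InnerProductSpace.toDual ℝ (Vec p)).symm.contDiff.comp (hf.fderiv_right h)

theorem hasDerivAt_line (hf : Differentiable ℝ f) (θ v : Vec p) (t : ℝ) :
    HasDerivAt (fun s : ℝ => f (θ + s • v)) (inner ℝ (gradient f (θ + t • v)) v) t := by
  have h1 : HasDerivAt (fun s : ℝ => θ + s • v) v t := by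
    simpa using ((hasDerivAt_id t).smul_const v).const_add θ
  have h2 := (hf (θ + t • v)).hasGradientAt.hasFDerivAt.comp_hasDerivAt t h1
  rwa [InnerProductSpace.toDual_apply_apply] at h2

theorem hasDerivAt_inner_gradient_line (hf : ContDiff ℝ 2 f) (θ v u : Vec p) (t : ℝ) :
    HasDerivAt (fun s : ℝ => inner ℝ (gradient f (θ + s • v)) u)
      (inner ℝ u (mulV (hess f (θ + t • v)) v)) t := by
  have h1 : HasDerivAt (fun s : ℝ => θ + s • v) v t := by
    simpa using ((hasDerivAt_id t).smul_const v).const_add θ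
  have hg : ContDiff ℝ 1 (gradient f) := contDiff_gradient hf (by norm_num)
  have h2 := ((hg.differentiable (by norm_num)) (θ + t • v)).hasFDerivAt.comp_hasDerivAt t h1
  have h3 := h2.inner ℝ (hasDerivAt_const t u)
  simp only [inner_zero_right, zero_add, Function.comp_apply] at h3
  rw [hess, mulV_jacobian, real_inner_comm]
  exact h3

theorem differentiable_normSqMat_hess (hf : ContDiff ℝ 3 f) (u : Vec p) :
    Differentiable ℝ (fun y => normSqMat (hess f y) u) := by
  have hg : ContDiff ℝ 2 (gradient f) := contDiff_gradient hf (by norm_num)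
  have h : ContDiff ℝ 1 (fderiv ℝ (gradient f)) := hg.fderiv_right (by norm_num)
  have h' := h.differentiable (by norm_num)
  simp only [normSqMat_eq_inner, hess, mulV_jacobian]
  exact (differentiable_const u).inner ℝ (h'.clm_apply (differentiable_const u))

/-- Second order lower bound of a function of one variable by its tangent. -/
theorem tangent_le_of_deriv2_nonneg {ψ ψ' ψ'' : ℝ → ℝ} (h1 : ∀ t, HasDerivAt ψ (ψ' t) t)
    (h2 : ∀ t, HasDerivAt ψ' (ψ'' t) t) (h : ∀ t ∈ Set.Icc (0 : ℝ) 1, 0 ≤ ψ'' t) :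
    ψ 0 + ψ' 0 ≤ ψ 1 := by
  have hmono : MonotoneOn ψ' (Set.Icc 0 1) := by
    refine monotoneOn_of_hasDerivWithinAt_nonneg (convex_Icc 0 1)
      (fun t _ => (h2 t).continuousAt.continuousWithinAt)
      (fun t _ => (h2 t).hasDerivWithinAt) (fun t ht => h t (interior_subset ht))
  obtain ⟨c, hc, hc'⟩ := exists_hasDerivAt_eq_slope ψ ψ' (zero_lt_one)
    (fun t _ => (h1 t).continuousAt.continuousWithinAt) (fun t _ => h1 t)
  have := hmono (Set.left_mem_Icc.2 zero_le_one) (Set.Ioo_subset_Icc_self hc) hc.1.le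
  rw [hc'] at this
  linarith

theorem taylor_lower (hf : ContDiff ℝ 2 f) (θ v : Vec p) {m : ℝ}
    (hm : ∀ t ∈ Set.Icc (0 : ℝ) 1, m ≤ normSqMat (hess f (θ + t • v)) v) :
    f θ + inner ℝ (gradient f θ) v + m / 2 ≤ f (θ + v) := by
  have h := tangent_le_of_deriv2_nonneg
    (ψ := fun t => f (θ + t • v) - m / 2 * t ^ 2)
    (ψ' := fun t => inner ℝ (gradient f (θ + t • v)) v - m * t)
    (ψ'' := fun t => normSqMat (hess f (θ + t • v)) v - m)
    (fun t => by
      refine ((hasDerivAt_line (hf.differentiable (by norm_num)) θ v t).sub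
        ((hasDerivAt_pow 2 t).const_mul (m / 2))).congr_deriv ?_
      norm_num; ring)
    (fun t => by
      rw [normSqMat_eq_inner]
      refine ((hasDerivAt_inner_gradient_line hf θ v v t).sub
        ((hasDerivAt_id t).const_mul m)).congr_deriv ?_
      ring)
    (fun t ht => by linarith [hm t ht])
  simp only [zero_smul, one_smul, add_zero, mul_zero, mul_one, one_pow, sub_zero,
    ne_eq, OfNat.ofNat_ne_zero, not_false_eq_true, zero_pow] at h
  linarith

theorem taylor_upper (hf : ContDiff ℝ 2 f) (θ v : Vec p) {m : ℝ}
    (hm : ∀ t ∈ Set.Icc (0 : ℝ) 1, normSqMat (hess f (θ + t • v)) v ≤ m) :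
    f (θ + v) ≤ f θ + inner ℝ (gradient f θ) v + m / 2 := by
  have h := tangent_le_of_deriv2_nonneg
    (ψ := fun t => m / 2 * t ^ 2 - f (θ + t • v))
    (ψ' := fun t => m * t - inner ℝ (gradient f (θ + t • v)) v)
    (ψ'' := fun t => m - normSqMat (hess f (θ + t • v)) v)
    (fun t => by
      refine (((hasDerivAt_pow 2 t).const_mul (m / 2)).sub
        (hasDerivAt_line (hf.differentiable (by norm_num)) θ v t)).congr_deriv ?_
      norm_num; ring)
    (fun t => by
      rw [normSqMat_eq_inner]
      refine (((hasDerivAt_id t).const_mul m).sub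
        (hasDerivAt_inner_gradient_line hf θ v v t)).congr_deriv ?_
      ring)
    (fun t ht => by linarith [hm t ht])
  simp only [zero_smul, one_smul, add_zero, mul_zero, mul_one, one_pow, zero_sub,
    ne_eq, OfNat.ofNat_ne_zero, not_false_eq_true, zero_pow] at h
  linarith

end Calculus

/-! ### Hessian comparison from self-concordance. -/

section SelfConcordance

variable {p : ℕ} {f : Vec p → ℝ} {γ : ℝ}

theorem SelfConcordant.abs_fderiv_le (h : SelfConcordant γ 2 f) (x u v : Vec p) :
    |fderiv ℝ (fun y => normSqMat (hess f y) u) x v| ≤ γ * normSqMat (hess f x) u * ‖v‖ := by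
  have := h.bound x u v
  norm_num at this
  exact this

/-- Grönwall along the segment: `q t = uᵀ ∇²f(θ + t v) u` satisfies `q' ≤ γ ‖v‖ q`, so `exp (-γ ‖v‖
t) q t` is antitone. -/
theorem SelfConcordant.normSqMat_hess_add_le (h : SelfConcordant γ 2 f) (θ v u : Vec p) :
    normSqMat (hess f (θ + v)) u ≤ Real.exp (γ * ‖v‖) * normSqMat (hess f θ) u := by
  set q : ℝ → ℝ := fun t => normSqMat (hess f (θ + t • v)) u with hq
  have hd : ∀ t, HasDerivAt q (fderiv ℝ (fun y => normSqMat (hess f y) u) (θ + t • v) v) t := by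
    intro t
    have h1 : HasDerivAt (fun s : ℝ => θ + s • v) v t := by
      simpa using ((hasDerivAt_id t).smul_const v).const_add θ
    exact ((differentiable_normSqMat_hess h.contDiff u) _).hasFDerivAt.comp_hasDerivAt t h1
  have hd2 : ∀ t, HasDerivAt (fun t => Real.exp (-(γ * ‖v‖) * t) * q t)
      (Real.exp (-(γ * ‖v‖) * t) *
        (fderiv ℝ (fun y => normSqMat (hess f y) u) (θ + t • v) v - γ * ‖v‖ * q t)) t := by
    intro t
    have h1 : HasDerivAt (fun t => Real.exp (-(γ * ‖v‖) * t))
        (Real.exp (-(γ * ‖v‖) * t) * (-(γ * ‖v‖) * 1)) t :=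
      ((hasDerivAt_id t).const_mul (-(γ * ‖v‖))).exp
    refine (h1.mul (hd t)).congr_deriv ?_
    ring
  have hanti := antitone_of_hasDerivAt_nonpos hd2 (fun t => by
    refine mul_nonpos_of_nonneg_of_nonpos (Real.exp_pos _).le ?_
    have h2 := (abs_le.1 (h.abs_fderiv_le (θ + t • v) u v)).2
    simp only [hq]
    linarith)
  have := hanti (zero_le_one)
  simp only [hq, mul_one, one_smul, mul_zero, Real.exp_zero, zero_smul, add_zero, one_mul] at this
  rw [Real.exp_neg] at this
  calc _ = Real.exp (γ * ‖v‖) * ((Real.exp (γ * ‖v‖))⁻¹ * normSqMat (hess f (θ + v)) u) := by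
        rw [mul_inv_cancel_left₀ (Real.exp_pos _).ne']
    _ ≤ _ := by gcongr

theorem SelfConcordant.exp_neg_mul_le_normSqMat_hess (h : SelfConcordant γ 2 f) (θ v u : Vec p) :
    Real.exp (-(γ * ‖v‖)) * normSqMat (hess f θ) u ≤ normSqMat (hess f (θ + v)) u := by
  have := h.normSqMat_hess_add_le (θ + v) (-v) u
  rw [norm_neg, add_neg_cancel_right] at this
  rw [Real.exp_neg, inv_mul_le_iff₀ (Real.exp_pos _)]
  exact this

/-- With `s = γ ‖v‖`, the second derivative along the segment is at least `q exp (-s t)`.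
Integrating twice from the critical point `θhat` produces `q g(s) / s²`. -/
theorem SelfConcordant.gFun_le (h : SelfConcordant γ 2 f) (hγ : 0 < γ) {θhat : Vec p}
    (hmin : gradient f θhat = 0) (v : Vec p) (hv : v ≠ 0) :
    normSqMat (hess f θhat) v / (γ * ‖v‖) ^ 2 * gFun (γ * ‖v‖) ≤ f (θhat + v) - f θhat := by
  have hs : 0 < γ * ‖v‖ := mul_pos hγ (norm_pos_iff.2 hv)
  set s := γ * ‖v‖ with hs_def
  set q := normSqMat (hess f θhat) v
  have hf2 : ContDiff ℝ 2 f := h.contDiff.of_le (by norm_num)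
  have hE : ∀ t : ℝ, HasDerivAt (fun t => Real.exp (-s * t)) (Real.exp (-s * t) * (-s * 1)) t :=
    fun t => ((hasDerivAt_id t).const_mul (-s)).exp
  have key := tangent_le_of_deriv2_nonneg
    (ψ := fun t => f (θhat + t • v) - q / s ^ 2 * (Real.exp (-s * t) + s * t - 1))
    (ψ' := fun t => inner ℝ (gradient f (θhat + t • v)) v - q / s * (1 - Real.exp (-s * t)))
    (ψ'' := fun t => normSqMat (hess f (θhat + t • v)) v - q * Real.exp (-s * t))
    (fun t => by
      have h1 := (((hE t).add ((hasDerivAt_id t).const_mul s)).sub_const 1).const_mul (q / s ^ 2)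
      refine ((hasDerivAt_line (hf2.differentiable (by norm_num)) θhat v t).sub h1).congr_deriv ?_
      field_simp
      ring)
    (fun t => by
      have h1 := ((hE t).const_sub 1).const_mul (q / s)
      rw [normSqMat_eq_inner]
      refine ((hasDerivAt_inner_gradient_line hf2 θhat v v t).sub h1).congr_deriv ?_
      field_simp)
    (fun t ht => by
      have := h.exp_neg_mul_le_normSqMat_hess θhat (t • v) v
      rw [norm_smul, Real.norm_of_nonneg ht.1,
        show -(γ * (t * ‖v‖)) = -s * t by rw [hs_def]; ring] at this
      linarith)
  simp [hmin] at key
  simp only [gFun]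
  linarith

end SelfConcordance

/-! ### The function `g` and its inverse. -/

section GFun

theorem strictMonoOn_gFun : StrictMonoOn gFun (Set.Ici 0) := by
  refine strictMonoOn_of_deriv_pos (convex_Ici 0) (by unfold gFun; fun_prop) (fun t ht => ?_)
  rw [interior_Ici] at ht
  have h1 : HasDerivAt gFun (Real.exp (-t) * (-1) + 1) t :=
    (((hasDerivAt_id t).neg.exp).add (hasDerivAt_id t)).sub_const 1
  rw [h1.deriv]
  have : Real.exp (-t) < 1 := by simpa using ht
  linarith

theorem mem_image_gFun {y : ℝ} (hy : 0 < y) : y ∈ gFun '' Set.Ioi 0 := by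
  have hc : ContinuousOn gFun (Set.Icc 0 (y + 1)) := by unfold gFun; fun_prop
  have h0 : gFun 0 = 0 := by simp [gFun]
  have h1 : y ≤ gFun (y + 1) := by
    have := Real.exp_pos (-(y + 1))
    simp only [gFun]; linarith
  obtain ⟨t, ht, hty⟩ := intermediate_value_Icc (by linarith) hc ⟨by rw [h0]; exact hy.le, h1⟩
  refine ⟨t, lt_of_le_of_ne ht.1 ?_, hty⟩
  rintro rfl
  rw [h0] at hty
  exact hy.ne hty

theorem gInv_pos {y : ℝ} (hy : 0 < y) : 0 < gInv y :=
  Function.invFunOn_mem (mem_image_gFun hy)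

theorem gFun_gInv {y : ℝ} (hy : 0 < y) : gFun (gInv y) = y :=
  Function.invFunOn_eq (mem_image_gFun hy)

theorem le_gInv {y t : ℝ} (hy : 0 < y) (ht : 0 ≤ t) (h : gFun t ≤ y) : t ≤ gInv y := by
  rw [← gFun_gInv hy] at h
  exact (strictMonoOn_gFun.le_iff_le ht (gInv_pos hy).le).1 h

end GFun

/-! ### One noisy Newton step. -/

section Descent

variable {p : ℕ} {f : Vec p → ℝ} {γ R τ b ε : ℝ} {θhat θ w e : Vec p} {E : Mat p}

theorem inner_gradient_of_noisy_solution (hw : mulV (hess f θ + E) w = gradient f θ + e)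
    (v : Vec p) : inner ℝ (gradient f θ) v =
      inner ℝ v (mulV (hess f θ) w) + inner ℝ v (mulV E w) - inner ℝ e v := by
  have h : gradient f θ = mulV (hess f θ) w + mulV E w - e := by
    rw [← mulV_add_left, hw, add_sub_cancel_right]
  rw [h, inner_sub_left, inner_add_left, real_inner_comm v, real_inner_comm v]

/-- The optimality gap is controlled by the noisy Newton decrement, as soon as the Hessian along
the segment to the minimizer dominates a multiple of the current Hessian. -/
theorem gap_le_of_noisy_solution (hf : ContDiff ℝ 2 f) (hsymm : (hess f θ).IsSymm) (hτ : 0 < τ)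
    (hH : ∀ u, τ * ‖u‖ ^ 2 ≤ normSqMat (hess f θ) u)
    (hE : ∀ u v, |inner ℝ u (mulV E v)| ≤ τ / 32 * ‖u‖ * ‖v‖) (he : ‖e‖ ≤ ε)
    (hw : mulV (hess f θ + E) w = gradient f θ + e) {q : ℝ} (hq : 0 < q)
    (hseg : ∀ t ∈ Set.Icc (0 : ℝ) 1, q * normSqMat (hess f θ) (θhat - θ) ≤
      normSqMat (hess f (θ + t • (θhat - θ))) (θhat - θ)) :
    2 * q * (f θ - f θhat) ≤ 11 / 10 * normSqMat (hess f θ) w + 32 * ε ^ 2 / τ := by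
  set v := θhat - θ with hv
  set N := normSqMat (hess f θ) w
  set M := normSqMat (hess f θ) v
  have h1 := taylor_lower hf θ v hseg
  rw [hv, add_sub_cancel, ← hv, inner_gradient_of_noisy_solution hw v] at h1
  -- Completing the square. The terms in `E` and `e` each cost `q² M / 32`, leaving `15/16` of the
  -- quadratic term `q² M`; optimizing over it costs `16/15 * N`, and `16/15 + 1/32 ≤ 11/10`.
  have hx : 0 ≤ normSqMat (hess f θ) (w + (15 / 16 * q) • v) :=
    le_trans (by positivity) (hH _)
  rw [normSqMat_add hsymm, normSqMat_smul, inner_mulV_comm hsymm, inner_smul_left] at hx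
  simp only [conj_trivial] at hx
  have h2 := (abs_le.1 (hE v w)).1
  have h3 : inner ℝ e v ≤ ε * ‖v‖ :=
    (real_inner_le_norm e v).trans (mul_le_mul_of_nonneg_right he (norm_nonneg _))
  have hN : τ * ‖w‖ ^ 2 ≤ N := hH w
  have hM : τ * ‖v‖ ^ 2 ≤ M := hH v
  -- Writing `ε = δ τ` removes the division, so that the remaining inequality is linear in the
  -- products listed below.
  obtain ⟨δ, rfl⟩ : ∃ δ, ε = δ * τ := ⟨ε / τ, by field_simp⟩
  have hε : 32 * (δ * τ) ^ 2 / τ = 32 * δ ^ 2 * τ := by field_simp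
  rw [hε]
  have h4 : 0 ≤ τ / 32 * (q * ‖v‖ - ‖w‖) ^ 2 := by positivity
  have h5 : 0 ≤ τ / 32 * (q * ‖v‖ - 32 * δ) ^ 2 := by positivity
  have h6 := mul_le_mul_of_nonneg_left hM (sq_nonneg q)
  have h7 := mul_le_mul_of_nonneg_left h1 (by positivity : 0 ≤ 2 * q)
  have h8 := mul_le_mul_of_nonneg_left h2 (by positivity : 0 ≤ 2 * q)
  have h9 := mul_le_mul_of_nonneg_left h3 (by positivity : 0 ≤ 2 * q)
  have h10 : 0 ≤ τ * ‖w‖ ^ 2 := by positivity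
  linarith

/-- Decrease along the noisy Newton direction, for steps whose length is at most slightly more
than twice the radius. -/
theorem noisy_newton_decrease (h : SelfConcordant γ 2 f) (hτ : 0 < τ)
    (hH : ∀ u, τ * ‖u‖ ^ 2 ≤ normSqMat (hess f θ) u)
    (hE : ∀ u v, |inner ℝ u (mulV E v)| ≤ τ / 32 * ‖u‖ * ‖v‖) (he : ‖e‖ ≤ ε)
    (hw : mulV (hess f θ + E) w = gradient f θ + e) (hγ : 0 < γ) {s : ℝ} (hs : 0 ≤ s)
    (hsR : s * Real.exp (2 * γ * R) ≤ 1 / 2)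
    (hlen : γ * (s * ‖w‖) ≤ 2 * γ * R + Real.log (5 / 4)) :
    f (θ - s • w) ≤ f θ - s * (5 / 8 * normSqMat (hess f θ) w - 8 * ε ^ 2 / τ) := by
  set N := normSqMat (hess f θ) w with hN_def
  have hN : τ * ‖w‖ ^ 2 ≤ N := hH w
  have hN0 : 0 ≤ N := le_trans (by positivity) hN
  have h1 := taylor_upper (h.contDiff.of_le (by norm_num)) θ (-(s • w))
    (m := 5 / 4 * Real.exp (2 * γ * R) * (s ^ 2 * N)) (fun t ht => by
      refine (h.normSqMat_hess_add_le θ _ _).trans ?_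
      rw [← neg_smul, normSqMat_smul, neg_sq, norm_smul, norm_smul, norm_neg,
        Real.norm_of_nonneg ht.1, Real.norm_of_nonneg hs]
      refine mul_le_mul_of_nonneg_right ?_ (by positivity)
      rw [mul_comm (5 / 4), ← Real.exp_log (show (0 : ℝ) < 5 / 4 by norm_num), ← Real.exp_add]
      refine Real.exp_le_exp.2 (le_trans ?_ hlen)
      have := mul_le_mul_of_nonneg_right ht.2 (by positivity : 0 ≤ γ * (s * ‖w‖))
      linarith)
  rw [← sub_eq_add_neg, inner_neg_right, inner_smul_right,
    inner_gradient_of_noisy_solution hw w, ← normSqMat_eq_inner, ← hN_def] at h1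
  have h2 := (abs_le.1 (hE w w)).1
  have h3 : inner ℝ e w ≤ ε * ‖w‖ :=
    (real_inner_le_norm e w).trans (mul_le_mul_of_nonneg_right he (norm_nonneg _))
  have h4 := mul_le_mul_of_nonneg_right hsR (by positivity : 0 ≤ s * N)
  obtain ⟨δ, rfl⟩ : ∃ δ, ε = δ * τ := ⟨ε / τ, by field_simp⟩
  have hε : 8 * (δ * τ) ^ 2 / τ = 8 * δ ^ 2 * τ := by field_simp
  rw [hε]
  have h5 : 0 ≤ τ / 32 * (‖w‖ - 16 * δ) ^ 2 := by positivity
  -- `E` and `e` cost `N / 32` each. The curvature term is at most `5/8 * 1/2 * s * N = 5/16 * s *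
  -- N`, which leaves the coefficient `15/16 - 5/16 = 5/8`.
  have h6 : 15 / 16 * N - 8 * δ ^ 2 * τ ≤ N + inner ℝ w (mulV E w) - inner ℝ e w := by
    linarith
  have h7 := mul_le_mul_of_nonneg_left h6 hs
  linarith

/-- The Hessian lower bound along the segment to the minimizer. -/
theorem hess_segment_lower (h : SelfConcordant γ 2 f) (hγ : 0 < γ) (hb : 0 < b) (hτ : 0 < τ)
    (hball : ∀ θ ∈ Metric.closedBall θhat R, ∀ u, τ * ‖u‖ ^ 2 ≤ normSqMat (hess f θ) u)
    (hupper : ∀ θ u, normSqMat (hess f θ) u ≤ b * ‖u‖ ^ 2) (hθ : θ ∈ Metric.closedBall θhat R)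
    {t : ℝ} (ht : t ∈ Set.Icc (0 : ℝ) 1) :
    max (Real.exp (-(γ * R))) (τ / b) * normSqMat (hess f θ) (θhat - θ) ≤
      normSqMat (hess f (θ + t • (θhat - θ))) (θhat - θ) := by
  have hR : ‖θhat - θ‖ ≤ R := by rwa [← dist_eq_norm, dist_comm]
  have hM : 0 ≤ normSqMat (hess f θ) (θhat - θ) := le_trans (by positivity) (hball θ hθ _)
  rw [max_mul_of_nonneg _ _ hM]
  refine max_le ?_ ?_
  · refine le_trans ?_ (h.exp_neg_mul_le_normSqMat_hess θ _ _)
    refine mul_le_mul_of_nonneg_right (Real.exp_le_exp.2 (neg_le_neg ?_)) hM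
    rw [norm_smul, Real.norm_of_nonneg ht.1]
    refine mul_le_mul_of_nonneg_left (le_trans ?_ hR) hγ.le
    exact mul_le_of_le_one_left (norm_nonneg _) ht.2
  · have hmem : θ + t • (θhat - θ) ∈ Metric.closedBall θhat R :=
      (convex_closedBall θhat R).add_smul_sub_mem hθ
        (Metric.mem_closedBall_self ((norm_nonneg _).trans hR)) ht
    refine le_trans ?_ (hball _ hmem _)
    rw [div_mul_eq_mul_div, div_le_iff₀ hb, mul_assoc, mul_comm _ b]
    exact mul_le_mul_of_nonneg_left (hupper θ _) hτ.le

/-- Sublevel sets of a self-concordant function are contained in a ball around the minimizer. -/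
theorem SelfConcordant.mem_closedBall (h : SelfConcordant γ 2 f) (hγ : 0 < γ)
    (hmin : gradient f θhat = 0) (hsymm : (hess f θhat).IsSymm)
    (hlam : 0 < lamMin (hess f θhat)) {Δ : ℝ} (hΔ : 0 < Δ)
    (hR : γ⁻¹ * gInv (γ ^ 2 * Δ / lamMin (hess f θhat)) ≤ R) (hθ : f θ - f θhat ≤ Δ) :
    θ ∈ Metric.closedBall θhat R := by
  rw [mem_closedBall_iff_norm]
  refine le_trans ?_ hR
  have hy : 0 < γ ^ 2 * Δ / lamMin (hess f θhat) := by positivity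
  rcases eq_or_ne (θ - θhat) 0 with hv | hv
  · rw [hv, norm_zero]
    exact mul_nonneg (inv_nonneg.2 hγ.le) (gInv_pos hy).le
  rw [le_inv_mul_iff₀ hγ]
  have hv' := norm_pos_iff.2 hv
  refine le_gInv hy (by positivity) ?_
  have h1 := h.gFun_le hγ hmin _ hv
  rw [add_sub_cancel] at h1
  have h2 := lamMin_mul_le _ hsymm (θ - θhat)
  have hg : 0 ≤ gFun (γ * ‖θ - θhat‖) := by
    have := Real.add_one_le_exp (-(γ * ‖θ - θhat‖))
    simp only [gFun]; linarith
  rw [le_div_iff₀ hlam]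
  have h3 : lamMin (hess f θhat) / γ ^ 2 ≤
      normSqMat (hess f θhat) (θ - θhat) / (γ * ‖θ - θhat‖) ^ 2 := by
    rw [div_le_div_iff₀ (by positivity) (by positivity)]
    have := mul_le_mul_of_nonneg_right h2 (sq_nonneg γ)
    linarith
  have h4 := (mul_le_mul_of_nonneg_right h3 hg).trans (h1.trans hθ)
  rw [div_mul_eq_mul_div, div_le_iff₀ (by positivity)] at h4
  linarith

/-- One step of the noisy damped Newton method from the sublevel set of height `Δ`. -/
theorem noisy_newton_step (h : SelfConcordant γ 2 f) (hγ : 0 < γ) (hb : 0 < b) (hτ : 0 < τ)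
    (hτb : τ ≤ b) (hR : 0 ≤ R) (hsymm : ∀ θ, (hess f θ).IsSymm)
    (hball : ∀ θ ∈ Metric.closedBall θhat R, ∀ u, τ * ‖u‖ ^ 2 ≤ normSqMat (hess f θ) u)
    (hupper : ∀ θ u, normSqMat (hess f θ) u ≤ b * ‖u‖ ^ 2) {Δ : ℝ}
    (hlevel : ∀ θ, f θ - f θhat ≤ Δ → θ ∈ Metric.closedBall θhat R)
    (hθ : f θ - f θhat ≤ Δ)
    (hE : ∀ u v, |inner ℝ u (mulV E v)| ≤ τ / 32 * ‖u‖ * ‖v‖) (he : ‖e‖ ≤ ε)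
    (hε : 32 * ε ^ 2 / τ ≤ max (Real.exp (-(γ * R))) (τ / b) * Δ)
    (hw : mulV (hess f θ + E) w = gradient f θ + e)
    {η : ℝ} (hη : 0 < η) (hηR : η ≤ 1 / (2 * Real.exp (2 * γ * R))) :
    f (θ - η • w) - f θhat ≤ Δ ∧
    f (θ - η • w) - f θhat ≤ (1 - η * max (Real.exp (-(γ * R))) (τ / b)) * (f θ - f θhat)
      + η * (32 * ε ^ 2 / τ) := by
  set q := max (Real.exp (-(γ * R))) (τ / b) with hq_def
  have hq : 0 < q := lt_max_of_lt_left (Real.exp_pos _)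
  have hq1 : q ≤ 1 := by
    refine max_le (Real.exp_le_one_iff.2 ?_) ((div_le_one hb).2 hτb)
    have : 0 ≤ γ * R := by positivity
    linarith
  have hmem := hlevel θ hθ
  have hgap := gap_le_of_noisy_solution (h.contDiff.of_le (by norm_num)) (hsymm θ) hτ
    (hball θ hmem) hE he hw hq
    (fun t ht => hess_segment_lower h hγ hb hτ hball hupper hmem ht)
  have hηR' : η * Real.exp (2 * γ * R) ≤ 1 / 2 := by
    rw [le_div_iff₀ (by positivity)] at hηR
    linarith
  have hη1 : η ≤ 1 / 2 := by
    refine le_trans (le_mul_of_one_le_right hη.le (Real.one_le_exp ?_)) hηR'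
    positivity
  have hδ : 0 ≤ ε ^ 2 / τ := by positivity
  have step : ∀ s, 0 ≤ s → s ≤ η → γ * (s * ‖w‖) ≤ 2 * γ * R + Real.log (5 / 4) →
      f (θ - s • w) - f θhat ≤ (1 - s * q) * (f θ - f θhat) + s * (32 * ε ^ 2 / τ) := by
    intro s hs hsη hlen
    have h1 := noisy_newton_decrease h hτ (hball θ hmem) hE he hw hγ hs
      ((mul_le_mul_of_nonneg_right hsη (Real.exp_pos _).le).trans hηR') hlen
    have h2 : q * (f θ - f θhat) - 32 * ε ^ 2 / τ ≤
        5 / 8 * normSqMat (hess f θ) w - 8 * ε ^ 2 / τ := by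
      have h3 : 0 ≤ normSqMat (hess f θ) w := le_trans (by positivity) (hball θ hmem w)
      rw [mul_div_assoc] at hgap ⊢
      rw [mul_div_assoc]
      linarith
    have h3 := mul_le_mul_of_nonneg_left h2 hs
    linarith
  -- By `hε` the noise is at most `s q Δ`, exactly what the contraction gains at level `Δ`.
  have stay : ∀ s, 0 ≤ s → s ≤ η → γ * (s * ‖w‖) ≤ 2 * γ * R + Real.log (5 / 4) →
      f (θ - s • w) - f θhat ≤ Δ := by
    intro s hs hsη hlen
    refine (step s hs hsη hlen).trans ?_
    have h1 : 0 ≤ 1 - s * q := by nlinarith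
    have h2 := mul_le_mul_of_nonneg_left hθ h1
    have h3 := mul_le_mul_of_nonneg_left hε hs
    linarith
  have hlog : 0 < Real.log (5 / 4) := Real.log_pos (by norm_num)
  -- A full step cannot be too long: shortened until its length is exactly critical, it would still
  -- end in the sublevel set. Both endpoints then lie in the ball, so its length is at most `2 R`,
  -- and the surplus `log (5/4)` is a contradiction.
  have hlen : γ * (η * ‖w‖) ≤ 2 * γ * R + Real.log (5 / 4) := by
    by_contra! hcon
    have hw0 : 0 < ‖w‖ := by
      refine lt_of_le_of_ne (norm_nonneg _) fun h0 => ?_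
      rw [← h0] at hcon
      have : 0 ≤ 2 * γ * R := by positivity
      linarith
    set s := (2 * γ * R + Real.log (5 / 4)) / (γ * ‖w‖) with hs_def
    have hs : 0 ≤ s := by positivity
    have hs1 : γ * (s * ‖w‖) = 2 * γ * R + Real.log (5 / 4) := by
      rw [hs_def]; field_simp
    have hsη : s ≤ η := by
      rw [hs_def, div_le_iff₀ (by positivity)]
      linarith
    have h1 := hlevel _ (stay s hs hsη hs1.le)
    rw [mem_closedBall_iff_norm] at h1 hmem
    have h2 : s * ‖w‖ ≤ 2 * R := by
      calc s * ‖w‖ = ‖(θ - θhat) - (θ - s • w - θhat)‖ := by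
            rw [sub_sub_sub_cancel_right, sub_sub_cancel, norm_smul, Real.norm_of_nonneg hs]
        _ ≤ _ := (norm_sub_le _ _).trans (by linarith)
    have h3 := mul_le_mul_of_nonneg_left h2 hγ.le
    linarith
  exact ⟨stay η hη.le le_rfl hlen, step η hη.le le_rfl hlen⟩

end Descent

/-- Solution of a linear recursive inequality. -/
theorem le_of_linear_recursion {a : ℕ → ℝ} {r δ : ℝ} (hr1 : r ≤ 1) (hδ : 0 ≤ δ) {K : ℕ}
    (h : ∀ k < K, a (k + 1) ≤ (1 - r) * a k + r * δ) :
    a K ≤ (1 - r) ^ K * a 0 + δ := by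
  have : ∀ k ≤ K, a k ≤ (1 - r) ^ k * a 0 + δ := by
    intro k
    induction k with
    | zero => intro _; simp [hδ]
    | succ k ih =>
      intro hk
      have h1 := mul_le_mul_of_nonneg_left (ih (by omega)) (by linarith : 0 ≤ 1 - r)
      have h2 := h k (by omega)
      rw [pow_succ]
      linarith
  exact this K le_rfl

/-! ### Discretization of the operator norm. -/

section Net

/-- A `1`-net of the Euclidean ball of radius `2` with at most `5 ^ p` points. -/
theorem exists_net (p : ℕ) : ∃ N : Finset (Vec p), N.card ≤ 5 ^ p ∧ (∀ y ∈ N, ‖y‖ ≤ 2) ∧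
    ∀ x : Vec p, ‖x‖ ≤ 2 → ∃ y ∈ N, ‖x - y‖ ≤ 1 := by
  classical
  let S : Set ℕ := {m | ∃ N : Finset (Vec p), N.card = m ∧ (∀ y ∈ N, ‖y‖ ≤ 2) ∧
    ∀ c ∈ N, ∀ d ∈ N, c ≠ d → 1 ≤ ‖c - d‖}
  have hb : ∀ m ∈ S, m ≤ 5 ^ p := by
    rintro m ⟨N, rfl, h1, h2⟩
    simpa using Besicovitch.card_le_of_separated N h1 h2
  have hbdd : BddAbove S := ⟨5 ^ p, hb⟩
  -- A `1`-separated set of maximal cardinality is a `1`-net, since an uncovered point could be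
  -- added to it.
  have hmem : sSup S ∈ S := Nat.sSup_mem ⟨0, ∅, by simp⟩ hbdd
  obtain ⟨N, hN, h1, h2⟩ := id hmem
  refine ⟨N, hN ▸ hb _ hmem, h1, fun x hx => ?_⟩
  by_contra! hcon
  have hxN : x ∉ N := fun hxN => by
    have := hcon x hxN
    simp at this
    linarith
  have hins : N.card + 1 ∈ S := by
    refine ⟨insert x N, Finset.card_insert_of_notMem hxN, ?_, ?_⟩
    · intro y hy
      rcases Finset.mem_insert.1 hy with rfl | hy
      exacts [hx, h1 y hy]
    · intro c hc d hd hcd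
      rcases Finset.mem_insert.1 hc with rfl | hc <;> rcases Finset.mem_insert.1 hd with rfl | hd
      · exact absurd rfl hcd
      · exact (hcon d hd).le
      · rw [norm_sub_rev]; exact (hcon c ‹c ∈ N›).le
      · exact h2 c hc d hd hcd
  have := le_csSup hbdd hins
  omega

variable {p : ℕ} {N : Finset (Vec p)}

/-- For `y` within `1` of `2 x / ‖x‖` one gets `2 ‖x‖ ≤ ⟪y, x⟫ + ‖x‖`. Radius `2` against mesh `1`
lets the error be absorbed with no loss in the constant. -/
theorem norm_le_of_net (hN : ∀ x : Vec p, ‖x‖ ≤ 2 → ∃ y ∈ N, ‖x - y‖ ≤ 1) {x : Vec p} {m : ℝ}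
    (hm : 0 ≤ m) (h : ∀ y ∈ N, inner ℝ y x ≤ m) : ‖x‖ ≤ m := by
  rcases eq_or_ne x 0 with rfl | hx
  · simpa using hm
  have hx' := norm_pos_iff.2 hx
  obtain ⟨y, hy, hxy⟩ := hN ((2 / ‖x‖) • x) (by
    rw [norm_smul, Real.norm_of_nonneg (by positivity)]; field_simp; rfl)
  have h1 : inner ℝ ((2 / ‖x‖) • x) x = 2 * ‖x‖ := by
    rw [inner_smul_left, real_inner_self_eq_norm_sq]
    simp only [conj_trivial]; field_simp
  have h2 := real_inner_le_norm ((2 / ‖x‖) • x - y) x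
  have h3 := mul_le_mul_of_nonneg_right hxy hx'.le
  rw [inner_sub_left, h1] at h2
  linarith [h y hy]

theorem opNorm_le_of_net (hN : ∀ x : Vec p, ‖x‖ ≤ 2 → ∃ y ∈ N, ‖x - y‖ ≤ 1)
    (T : Vec p →L[ℝ] Vec p) {m : ℝ} (hm : 0 ≤ m) (h : ∀ z ∈ N, ‖T z‖ ≤ m) : ‖T‖ ≤ m := by
  have h1 : ‖T‖ ≤ (m + ‖T‖) / 2 := by
    refine T.opNorm_le_bound (by positivity) fun v => ?_
    rcases eq_or_ne v 0 with rfl | hv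
    · simp
    have hv' := norm_pos_iff.2 hv
    obtain ⟨z, hz, hvz⟩ := hN ((2 / ‖v‖) • v) (by
      rw [norm_smul, Real.norm_of_nonneg (by positivity)]; field_simp; rfl)
    have h2 : ‖T ((2 / ‖v‖) • v)‖ ≤ m + ‖T‖ := by
      calc ‖T ((2 / ‖v‖) • v)‖ = ‖T z + T ((2 / ‖v‖) • v - z)‖ := by rw [← map_add]; simp
        _ ≤ ‖T z‖ + ‖T ((2 / ‖v‖) • v - z)‖ := norm_add_le _ _
        _ ≤ m + ‖T‖ * 1 := add_le_add (h z hz)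
            ((T.le_opNorm _).trans (mul_le_mul_of_nonneg_left hvz (norm_nonneg _)))
        _ = m + ‖T‖ := by rw [mul_one]
    rw [map_smul, norm_smul, Real.norm_of_nonneg (by positivity), div_mul_eq_mul_div,
      div_le_iff₀ hv'] at h2
    linarith
  linarith

/-- The bilinear form of a matrix is controlled by its values on a net. -/
theorem abs_inner_mulV_le_of_net (hN : ∀ x : Vec p, ‖x‖ ≤ 2 → ∃ y ∈ N, ‖x - y‖ ≤ 1)
    (A : Mat p) {s : ℝ} (hs : 0 ≤ s) (h : ∀ y ∈ N, ∀ z ∈ N, |inner ℝ y (mulV A z)| ≤ s)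
    (u v : Vec p) : |inner ℝ u (mulV A v)| ≤ s * ‖u‖ * ‖v‖ := by
  let T : Vec p →L[ℝ] Vec p := LinearMap.toContinuousLinearMap
    { toFun := mulV A
      map_add' := mulV_add_right A
      map_smul' := mulV_smul_right A }
  have hT : ∀ v, T v = mulV A v := fun v => rfl
  have h1 : ‖T‖ ≤ s := opNorm_le_of_net hN T hs fun z hz =>
    norm_le_of_net hN hs fun y hy => (le_abs_self _).trans (h y hy z hz)
  rw [← hT]
  calc |inner ℝ u (T v)| ≤ ‖u‖ * ‖T v‖ := abs_real_inner_le_norm _ _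
    _ ≤ ‖u‖ * (s * ‖v‖) := by
        gcongr
        exact (T.le_opNorm v).trans (by gcongr)
    _ = _ := by ring

end Net

/-! ### Tails and small balls of normal variables. -/

section Gaussian

variable {Ω : Type*} [MeasurableSpace Ω] {P : Measure Ω}

theorem hasSubgaussianMGF_of_hasLaw {X : Ω → ℝ} (h : HasLaw X (gaussianReal 0 1) P) :
    HasSubgaussianMGF X 1 P := by
  rw [← HasSubgaussianMGF.id_map_iff h.aemeasurable, h.map_eq]
  refine ⟨fun t => integrable_exp_mul_gaussianReal t, fun t => ?_⟩
  rw [mgf_id_gaussianReal]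
  simp

/-- Tail bound for linear combinations of independent standard normal variables. -/
theorem gaussian_sum_tail {ι : Type*} [Fintype ι] {X : ι → Ω → ℝ} (hindep : iIndepFun X P)
    (hlaw : ∀ i, HasLaw (X i) (gaussianReal 0 1) P) (a : ι → ℝ) {V : ℝ} (hV : 0 < V)
    (ha : ∑ i, a i ^ 2 ≤ V) {s : ℝ} (hs : 0 ≤ s) :
    P.real {ω | s ≤ |∑ i, a i * X i ω|} ≤ 2 * Real.exp (-s ^ 2 / (2 * V)) := by
  have := hindep.isProbabilityMeasure
  have h0 : ∀ i, HasSubgaussianMGF (fun ω => a i * X i ω) (a i ^ 2).toNNReal P := fun i => by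
    have := (hasSubgaussianMGF_of_hasLaw (hlaw i)).const_mul (a i)
    rw [← mul_one (a i ^ 2).toNNReal, Real.toNNReal_of_nonneg (sq_nonneg (a i))]
    exact this
  have h1 : HasSubgaussianMGF (fun ω => ∑ i, a i * X i ω) (∑ i, (a i ^ 2).toNNReal) P :=
    HasSubgaussianMGF.sum_of_iIndepFun
      (hindep.comp (fun i x => a i * x) (fun i => measurable_const_mul (a i)))
      (fun i _ => h0 i)
  have h2 : HasSubgaussianMGF (fun ω => ∑ i, a i * X i ω) V.toNNReal P := by
    refine ⟨h1.integrable_exp_mul, fun t => (h1.mgf_le t).trans (Real.exp_le_exp.2 ?_)⟩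
    refine div_le_div_of_nonneg_right (mul_le_mul_of_nonneg_right ?_ (sq_nonneg t)) two_pos.le
    rw [NNReal.coe_sum, Real.coe_toNNReal V hV.le]
    simpa only [Real.coe_toNNReal _ (sq_nonneg _)] using ha
  have h3 := h2.measure_ge_le hs
  have h4 := h2.neg.measure_ge_le hs
  have hsub : {ω | s ≤ |∑ i, a i * X i ω|} ⊆
      {ω | s ≤ ∑ i, a i * X i ω} ∪ {ω | s ≤ (-(fun ω => ∑ i, a i * X i ω)) ω} := by
    intro ω hω
    rcases le_abs.1 (show s ≤ |∑ i, a i * X i ω| from hω) with h | h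
    · exact Or.inl h
    · exact Or.inr h
  calc _ ≤ _ := measureReal_mono hsub
    _ ≤ _ := measureReal_union_le _ _
    _ ≤ _ := add_le_add h3 h4
    _ = _ := by rw [Real.coe_toNNReal V hV.le]; ring

/-- The density is at least `1/6` on `[-1, 1]`, and the interval has length `2 t`. -/
theorem div_three_le_gaussianReal_Icc {t : ℝ} (ht : 0 ≤ t) (ht1 : t ≤ 1) :
    t / 3 ≤ (gaussianReal 0 1).real {x | |x| ≤ t} := by
  have hset : {x : ℝ | |x| ≤ t} = Set.Icc (-t) t := by ext x; simp [abs_le]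
  have hpdf : ∀ x ∈ Set.Icc (-t) t, 1 / 6 ≤ gaussianPDFReal 0 1 x := by
    intro x hx
    have hx2 : x ^ 2 ≤ 1 := by
      rw [sq_le_one_iff_abs_le_one]
      exact (abs_le.2 hx).trans ht1
    have h1 : Real.sqrt (2 * Real.pi) ≤ 3 := by
      rw [Real.sqrt_le_left (by norm_num)]
      linarith [Real.pi_le_four]
    have h2 : 0 < Real.sqrt (2 * Real.pi) := by positivity
    have h3 : 1 / 2 ≤ Real.exp (-x ^ 2 / 2) := by
      have := Real.add_one_le_exp (-x ^ 2 / 2)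
      linarith
    have h4 : (3 : ℝ)⁻¹ ≤ (Real.sqrt (2 * Real.pi))⁻¹ := inv_anti₀ h2 h1
    simp only [gaussianPDFReal, NNReal.coe_one, mul_one, sub_zero]
    calc (1 : ℝ) / 6 = 3⁻¹ * (1 / 2) := by norm_num
      _ ≤ _ := mul_le_mul h4 h3 (by norm_num) (by positivity)
  rw [hset, measureReal_def, gaussianReal_apply_eq_integral _ one_ne_zero,
    ENNReal.toReal_ofReal (integral_nonneg fun x => gaussianPDFReal_nonneg _ _ _)]
  calc t / 3 = ∫ x in Set.Icc (-t) t, (1 / 6 : ℝ) := by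
        simp [measureReal_def, Real.volume_Icc]
        rw [ENNReal.toReal_ofReal (by linarith)]; ring
    _ ≤ _ := setIntegral_mono_on (by simp) (integrable_gaussianPDFReal 0 1).integrableOn
        measurableSet_Icc hpdf

end Gaussian

/-! ### Bilinear forms in the independent upper-triangular entries. -/

section SymmetricSum

variable {p : ℕ}

/-- The strict lower triangle is folded onto the upper one, whose entries are the independent ones
in the noise matrices. -/
theorem sum_prod_eq_sum_upper (F : Fin p × Fin p → ℝ) :
    ∑ q, F q = ∑ q : {ij : Fin p × Fin p // ij.1 ≤ ij.2},
      (F q.1 + if q.1.1 < q.1.2 then F q.1.swap else 0) := by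
  rw [← Finset.sum_subtype (Finset.univ.filter fun q : Fin p × Fin p => q.1 ≤ q.2) (by simp)
    (fun q => F q + if q.1 < q.2 then F q.swap else 0), Finset.sum_filter]
  have h1 : ∑ q : Fin p × Fin p, (if q.1 < q.2 then F q.swap else 0) =
      ∑ q : Fin p × Fin p, if q.2 < q.1 then F q else 0 :=
    (Equiv.prodComm (Fin p) (Fin p)).sum_comp (fun q => if q.2 < q.1 then F q else 0)
  have h2 : ∀ q : Fin p × Fin p, (if q.1 ≤ q.2 then F q + (if q.1 < q.2 then F q.swap else 0)
      else 0) = (if q.1 ≤ q.2 then F q else 0) + if q.1 < q.2 then F q.swap else 0 := by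
    intro q
    by_cases h : q.1 ≤ q.2
    · simp [h]
    · simp [h, not_lt.2 (not_le.1 h).le]
  rw [Finset.sum_congr rfl fun q _ => h2 q, Finset.sum_add_distrib, h1, ← Finset.sum_add_distrib]
  refine Finset.sum_congr rfl fun q _ => ?_
  by_cases h : q.1 ≤ q.2
  · simp [h, not_lt.2 h]
  · simp [h, not_le.1 h]

theorem inner_mulV_eq_sum_upper {A : Mat p} (hA : A.IsSymm) (y z : Vec p) :
    inner ℝ y (mulV A z) = ∑ q : {ij : Fin p × Fin p // ij.1 ≤ ij.2},
      (y q.1.1 * z q.1.2 + if q.1.1 < q.1.2 then y q.1.2 * z q.1.1 else 0) * A q.1.1 q.1.2 := by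
  have h1 : inner ℝ y (mulV A z) = ∑ q : Fin p × Fin p, y q.1 * z q.2 * A q.1 q.2 := by
    rw [Fintype.sum_prod_type]
    simp only [mulV, EuclideanSpace.inner_eq_star_dotProduct, star_trivial, dotProduct,
      Matrix.mulVec, Finset.sum_mul]
    exact Finset.sum_congr rfl fun i _ => Finset.sum_congr rfl fun j _ => by ring
  rw [h1, sum_prod_eq_sum_upper]
  refine Finset.sum_congr rfl fun q _ => ?_
  split_ifs with h
  · simp only [Prod.fst_swap, Prod.snd_swap, hA.apply q.1.1 q.1.2]; ring
  · ring

theorem sum_upper_coeff_sq_le (y z : Vec p) :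
    ∑ q : {ij : Fin p × Fin p // ij.1 ≤ ij.2},
      (y q.1.1 * z q.1.2 + if q.1.1 < q.1.2 then y q.1.2 * z q.1.1 else 0) ^ 2 ≤
      2 * (‖y‖ ^ 2 * ‖z‖ ^ 2) := by
  have h1 : ‖y‖ ^ 2 * ‖z‖ ^ 2 = ∑ q : Fin p × Fin p, (y q.1 * z q.2) ^ 2 := by
    rw [EuclideanSpace.real_norm_sq_eq, EuclideanSpace.real_norm_sq_eq, Finset.sum_mul_sum,
      Fintype.sum_prod_type]
    simp only [mul_pow]
  rw [h1, sum_prod_eq_sum_upper, Finset.mul_sum]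
  refine Finset.sum_le_sum fun q _ => ?_
  split_ifs with h
  · simp only [Prod.fst_swap, Prod.snd_swap]
    nlinarith [sq_nonneg (y q.1.1 * z q.1.2 - y q.1.2 * z q.1.1)]
  · nlinarith [sq_nonneg (y q.1.1 * z q.1.2)]

end SymmetricSum

/-! ### Probability of the noise event. -/

section NoiseEvent

variable {Ω : Type*} [MeasurableSpace Ω] {P : Measure Ω} {p K : ℕ}
  {Z : ℕ → Ω → Vec p} {W : ℕ → Ω → Mat p}

/-- The event that all noise vectors and noise matrices have norm at most `s`. -/
def noiseBounded (K : ℕ) (Z : ℕ → Ω → Vec p) (W : ℕ → Ω → Mat p) (s : ℝ) : Set Ω :=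
  {ω | ∀ k < K, ‖Z k ω‖ ≤ s ∧ ∀ u v, |inner ℝ u (mulV (W k ω) v)| ≤ s * ‖u‖ * ‖v‖}

omit [MeasurableSpace Ω] in
theorem noiseBounded_mono {s t : ℝ} (h : s ≤ t) :
    noiseBounded K Z W s ⊆ noiseBounded K Z W t := by
  intro ω hω k hk
  refine ⟨(hω k hk).1.trans h, fun u v => ((hω k hk).2 u v).trans ?_⟩
  gcongr

theorem norm_le_sqrt_mul_of_abs_le {x : Vec p} {m : ℝ} (hm : 0 ≤ m) (h : ∀ i, |x i| ≤ m) :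
    ‖x‖ ≤ Real.sqrt p * m := by
  rw [EuclideanSpace.norm_eq, ← Real.sqrt_sq hm, ← Real.sqrt_mul (Nat.cast_nonneg p)]
  refine Real.sqrt_le_sqrt ?_
  calc ∑ i, ‖x i‖ ^ 2 ≤ ∑ _i : Fin p, m ^ 2 :=
        Finset.sum_le_sum fun i _ => pow_le_pow_left₀ (norm_nonneg _) (h i) 2
    _ = _ := by simp

theorem IsNewtonNoise.vector_entry_tail (h : IsNewtonNoise P K Z W) (k : Fin K) (i : Fin p)
    {s : ℝ} (hs : 0 ≤ s) : P.real {ω | s ≤ |Z k ω i|} ≤ 2 * Real.exp (-s ^ 2 / 2) := by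
  have h1 := gaussian_sum_tail (ι := Unit) (P := P) (X := fun _ => noiseEntry K Z W (Sum.inl (k, i)))
    (h.indep.precomp (g := fun _ : Unit => Sum.inl (k, i)) (Function.injective_of_subsingleton _))
    (fun _ => h.law _) (fun _ => 1) one_pos (by simp) hs
  simpa [noiseEntry] using h1

theorem IsNewtonNoise.matrix_form_tail (h : IsNewtonNoise P K Z W) (k : Fin K) {y z : Vec p}
    (hy : ‖y‖ ≤ 2) (hz : ‖z‖ ≤ 2) {s : ℝ} (hs : 0 ≤ s) :
    P.real {ω | s ≤ |inner ℝ y (mulV (W k ω) z)|} ≤ 2 * Real.exp (-s ^ 2 / 64) := by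
  have hinj : Function.Injective (fun q : {ij : Fin p × Fin p // ij.1 ≤ ij.2} =>
      (Sum.inr (k, q) : (Fin K × Fin p) ⊕ (Fin K × {ij : Fin p × Fin p // ij.1 ≤ ij.2}))) := by
    intro a b hab
    simpa using hab
  have h1 := gaussian_sum_tail (P := P) (h.indep.precomp hinj) (fun _ => h.law _)
    (fun q => y q.1.1 * z q.1.2 + if q.1.1 < q.1.2 then y q.1.2 * z q.1.1 else 0)
    (V := 32) (by norm_num) ((sum_upper_coeff_sq_le y z).trans (by
      have h1 := pow_le_pow_left₀ (norm_nonneg y) hy 2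
      have h2 := pow_le_pow_left₀ (norm_nonneg z) hz 2
      have h3 := mul_le_mul h1 h2 (by positivity) (by positivity)
      linarith)) hs
  have h2 : {ω | s ≤ |inner ℝ y (mulV (W k ω) z)|} = {ω | s ≤
      |∑ q : {ij : Fin p × Fin p // ij.1 ≤ ij.2},
        (y q.1.1 * z q.1.2 + if q.1.1 < q.1.2 then y q.1.2 * z q.1.1 else 0) *
          noiseEntry K Z W (Sum.inr (k, q)) ω|} := by
    ext ω
    rw [Set.mem_ofPred_eq, Set.mem_ofPred_eq, inner_mulV_eq_sum_upper (h.symm k k.2 ω)]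
    rfl
  rw [h2]
  refine h1.trans (le_of_eq ?_)
  norm_num

/-- Union bound for the complement of the noise event. -/
theorem IsNewtonNoise.union_bound [IsProbabilityMeasure P] (h : IsNewtonNoise P K Z W) {s : ℝ}
    (hs : 0 ≤ s) : 1 - (K * p * (2 * Real.exp (-s ^ 2 / 2)) +
      K * (5 ^ p * 5 ^ p) * (2 * Real.exp (-(p * s ^ 2) / 64))) ≤
      P.real (noiseBounded K Z W (Real.sqrt p * s)) := by
  obtain ⟨N, hcard, hN2, hN⟩ := exists_net p
  set G := noiseBounded K Z W (Real.sqrt p * s)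
  let A : Set Ω := ⋃ q : Fin K × Fin p, {ω | s ≤ |Z q.1 ω q.2|}
  let B : Set Ω := ⋃ k : Fin K, ⋃ q ∈ N ×ˢ N,
    {ω | Real.sqrt p * s ≤ |inner ℝ q.1 (mulV (W k ω) q.2)|}
  -- Covering the whole space and using subadditivity avoids complements, so `G` need not be shown
  -- measurable.
  have hcover : (Set.univ : Set Ω) ⊆ G ∪ (A ∪ B) := by
    intro ω _
    by_contra hcon
    simp only [Set.mem_union, not_or] at hcon
    obtain ⟨hG, hA, hB⟩ := hcon
    simp only [A, B, Set.mem_iUnion, Set.mem_ofPred_eq, not_exists, not_le, Prod.forall,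
      Finset.mem_product] at hA hB
    refine hG fun k hk => ⟨norm_le_sqrt_mul_of_abs_le hs fun i => (hA ⟨k, hk⟩ i).le, ?_⟩
    exact abs_inner_mulV_le_of_net hN _ (by positivity)
      fun y hy z hz => (hB ⟨k, hk⟩ y z ⟨hy, hz⟩).le
  have hA : P.real A ≤ K * p * (2 * Real.exp (-s ^ 2 / 2)) := by
    refine (measureReal_iUnion_fintype_le _).trans ?_
    refine (Finset.sum_le_sum fun q _ => h.vector_entry_tail q.1 q.2 hs).trans (le_of_eq ?_)
    simp
  have hB : P.real B ≤ K * (5 ^ p * 5 ^ p) * (2 * Real.exp (-(p * s ^ 2) / 64)) := by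
    have h1 : ∀ k : Fin K, P.real (⋃ q ∈ N ×ˢ N,
        {ω | Real.sqrt p * s ≤ |inner ℝ q.1 (mulV (W k ω) q.2)|}) ≤
        (5 ^ p * 5 ^ p) * (2 * Real.exp (-(p * s ^ 2) / 64)) := by
      intro k
      refine (measureReal_biUnion_finset_le _ _).trans ?_
      have h2 : ∀ q ∈ N ×ˢ N,
          P.real {ω | Real.sqrt p * s ≤ |inner ℝ q.1 (mulV (W k ω) q.2)|} ≤
          2 * Real.exp (-(p * s ^ 2) / 64) := by
        intro q hq
        rw [Finset.mem_product] at hq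
        have h3 := h.matrix_form_tail k (hN2 _ hq.1) (hN2 _ hq.2)
          (s := Real.sqrt p * s) (by positivity)
        rwa [mul_pow, Real.sq_sqrt (Nat.cast_nonneg p)] at h3
      refine (Finset.sum_le_sum h2).trans ?_
      rw [Finset.sum_const, nsmul_eq_mul, Finset.card_product]
      push_cast
      have h4 : (N.card : ℝ) ≤ 5 ^ p := by exact_mod_cast hcard
      gcongr
    refine (measureReal_iUnion_fintype_le _).trans ?_
    refine (Finset.sum_le_sum fun k _ => h1 k).trans (le_of_eq ?_)
    simp; ring
  have h1 : 1 ≤ P.real G + (P.real A + P.real B) := by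
    calc (1 : ℝ) = P.real Set.univ := by simp
      _ ≤ P.real (G ∪ (A ∪ B)) := measureReal_mono hcover
      _ ≤ _ := (measureReal_union_le _ _).trans
          (add_le_add le_rfl (measureReal_union_le _ _))
  linarith

/-- For `K = p = 1` the noise is two independent normal scalars, so the small-ball probabilities
multiply. -/
theorem IsNewtonNoise.small_ball [IsProbabilityMeasure P] {Z : ℕ → Ω → Vec 1} {W : ℕ → Ω → Mat 1}
    (h : IsNewtonNoise P 1 Z W) {t : ℝ} (ht : 0 ≤ t) (ht1 : t ≤ 1) :
    (t / 3) ^ 2 ≤ P.real (noiseBounded 1 Z W t) := by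
  let a : (Fin 1 × Fin 1) ⊕ (Fin 1 × {ij : Fin 1 × Fin 1 // ij.1 ≤ ij.2}) := Sum.inl (0, 0)
  let b : (Fin 1 × Fin 1) ⊕ (Fin 1 × {ij : Fin 1 × Fin 1 // ij.1 ≤ ij.2}) :=
    Sum.inr (0, ⟨(0, 0), le_rfl⟩)
  have hab : a ≠ b := by simp [a, b]
  have hmeas : MeasurableSet {x : ℝ | |x| ≤ t} := measurableSet_le measurable_norm measurable_const
  have hind := (h.indep.indepFun hab).measure_inter_preimage_eq_mul _ _ hmeas hmeas
  have hsub : noiseEntry 1 Z W a ⁻¹' {x | |x| ≤ t} ∩ noiseEntry 1 Z W b ⁻¹' {x | |x| ≤ t} ⊆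
      noiseBounded 1 Z W t := by
    rintro ω ⟨h1, h2⟩ k hk
    obtain rfl : k = 0 := by omega
    simp only [Set.mem_preimage, Set.mem_ofPred_eq, noiseEntry, a, b, Fin.val_zero] at h1 h2
    have hnorm : ∀ x : Vec 1, ‖x‖ = |x 0| := fun x => by
      simp [EuclideanSpace.norm_eq, Real.sqrt_sq_eq_abs]
    refine ⟨by rw [hnorm]; exact h1, fun u v => ?_⟩
    have h3 : inner ℝ u (mulV (W 0 ω) v) = W 0 ω 0 0 * u 0 * v 0 := by
      simp [mulV, EuclideanSpace.inner_eq_star_dotProduct, dotProduct, Matrix.mulVec]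
      ring
    rw [h3, abs_mul, abs_mul, hnorm, hnorm]
    gcongr
  have hreal : ∀ e, t / 3 ≤ P.real (noiseEntry 1 Z W e ⁻¹' {x | |x| ≤ t}) := fun e => by
    have := (h.law e).measureReal_eq (p := fun x => |x| ≤ t) hmeas
    exact (div_three_le_gaussianReal_Icc ht ht1).trans this.ge
  refine le_trans ?_ (measureReal_mono hsub)
  rw [measureReal_def, hind, ENNReal.toReal_mul, sq]
  exact mul_le_mul (hreal a) (hreal b) (by positivity) (by positivity)

/-- With probability at least `1 - ξ` all noise terms are of order `√(p log (K p / ξ))`. -/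
theorem IsNewtonNoise.noiseBounded_prob [IsProbabilityMeasure P] (h : IsNewtonNoise P K Z W)
    (hp : 1 ≤ p) (hK : 1 ≤ K) {ξ : ℝ} (hξ : 0 < ξ) (hξ1 : ξ < 1) :
    1 - ξ ≤ P.real (noiseBounded K Z W
      (60 * (Real.sqrt p * Real.sqrt (Real.log ((K : ℝ) * p / ξ))))) := by
  set L := Real.log ((K : ℝ) * p / ξ) with hL_def
  have hK' : (1 : ℝ) ≤ K := by exact_mod_cast hK
  have hp' : (1 : ℝ) ≤ p := by exact_mod_cast hp
  have hpos : 0 < (K : ℝ) * p / ξ := by positivity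
  -- For `L ≥ 1/9` the factor `60` gives `60² L p / 64 ≥ L + 6 p`, and `exp (-6) ≤ 1/100` beats the
  -- `25 ^ p` pairs of net points. As `L → 0` the union bound becomes useless.
  rcases le_or_gt (1 / 9) L with hL | hL
  · have h1 := h.union_bound (s := 60 * Real.sqrt L) (by positivity)
    rw [show 60 * (Real.sqrt p * Real.sqrt L) = Real.sqrt p * (60 * Real.sqrt L) by ring]
    refine le_trans ?_ h1
    rw [mul_pow, Real.sq_sqrt (by linarith)]
    have hexp : Real.exp (-L) = ξ / (K * p) := by
      rw [Real.exp_neg, hL_def, Real.exp_log hpos, inv_div]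
    have h10 : (100 : ℝ) ≤ Real.exp 6 := by
      have h2 : (2.7 : ℝ) ≤ Real.exp 1 := by linarith [Real.exp_one_gt_d9]
      calc (100 : ℝ) ≤ 2.7 ^ 6 := by norm_num
        _ ≤ Real.exp 1 ^ 6 := by gcongr
        _ = Real.exp 6 := by rw [← Real.exp_nat_mul]; norm_num
    have h6 : Real.exp (-6) ≤ 1 / 100 := by
      rw [Real.exp_neg, one_div]
      exact inv_anti₀ (by norm_num) h10
    have hA : Real.exp (-(60 ^ 2 * L) / 2) ≤ ξ / (K * p) * (1 / 100) := by
      rw [← hexp]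
      refine le_trans ?_ (mul_le_mul_of_nonneg_left h6 (Real.exp_pos _).le)
      rw [← Real.exp_add]
      exact Real.exp_le_exp.2 (by linarith)
    have hB : Real.exp (-(p * (60 ^ 2 * L)) / 64) ≤ ξ / (K * p) * (1 / 100) ^ p := by
      rw [← hexp]
      refine le_trans ?_ (mul_le_mul_of_nonneg_left
        (pow_le_pow_left₀ (Real.exp_pos _).le h6 p) (Real.exp_pos _).le)
      rw [← Real.exp_nat_mul, ← Real.exp_add]
      refine Real.exp_le_exp.2 ?_
      have h2 : L ≤ p * L := le_mul_of_one_le_left (by linarith) hp'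
      have h3 : p * (1 / 9) ≤ p * L := by gcongr
      linarith
    have hA' : K * p * (2 * Real.exp (-(60 ^ 2 * L) / 2)) ≤ ξ / 2 := by
      calc K * p * (2 * Real.exp (-(60 ^ 2 * L) / 2))
          ≤ K * p * (2 * (ξ / (K * p) * (1 / 100))) := by gcongr
        _ = ξ / 50 := by field_simp; norm_num
        _ ≤ ξ / 2 := by linarith
    have hB' : K * (5 ^ p * 5 ^ p) * (2 * Real.exp (-(p * (60 ^ 2 * L)) / 64)) ≤ ξ / 2 := by
      calc K * (5 ^ p * 5 ^ p) * (2 * Real.exp (-(p * (60 ^ 2 * L)) / 64))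
          ≤ K * (5 ^ p * 5 ^ p) * (2 * (ξ / (K * p) * (1 / 100) ^ p)) := by gcongr
        _ = 2 * (ξ / p) * (1 / 4) ^ p := by
            rw [show (1 / 4 : ℝ) = 5 * 5 * (1 / 100) by norm_num, mul_pow, mul_pow]
            field_simp
        _ ≤ 2 * (ξ / 1) * (1 / 4) ^ 1 := by
            have : (1 / 4 : ℝ) ^ p ≤ (1 / 4) ^ 1 :=
              pow_le_pow_of_le_one (by norm_num) (by norm_num) hp
            gcongr
        _ = ξ / 2 := by ring
    linarith
  -- Small `L` forces `K = p = 1`, hence `L = log (1/ξ) ≥ 1 - ξ`. The small ball of radius `3 √L`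
  -- has probability at least `L`, which is enough.
  · have hlt : (K : ℝ) * p < 2 := by
      have h1 := Real.add_one_le_exp (-L)
      rw [Real.exp_neg, hL_def, Real.exp_log hpos, inv_div, ← hL_def,
        le_div_iff₀ (by positivity)] at h1
      nlinarith
    have hKp : K * p < 2 := by exact_mod_cast hlt
    obtain rfl : K = 1 := by nlinarith
    obtain rfl : p = 1 := by nlinarith
    have hL0 : 1 - ξ ≤ L := by
      have := Real.log_le_sub_one_of_pos hξ
      rw [hL_def]
      simp
      linarith
    have h3 : Real.sqrt L ≤ 1 / 3 := by
      rw [Real.sqrt_le_left (by norm_num)]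
      linarith
    have h1 := h.small_ball (t := 3 * Real.sqrt L) (by positivity) (by linarith)
    rw [mul_div_cancel_left₀ _ (by norm_num), Real.sq_sqrt (by linarith)] at h1
    refine (hL0.trans h1).trans (measureReal_mono (noiseBounded_mono ?_))
    have := Real.sqrt_nonneg L
    simp
    linarith

end NoiseEvent

/-! ### The empirical loss and its Hessian. -/

section EmpiricalLoss

variable {𝒳 : Type*} {n p : ℕ} {ρ : 𝒳 → Vec p → ℝ} {x : Fin n → 𝒳} {γ Bbar : ℝ}

theorem gradient_empLoss (hρ : ∀ y, Differentiable ℝ (ρ y)) (θ : Vec p) :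
    gradient (empLoss ρ x) θ = (n : ℝ)⁻¹ • ∑ i, score ρ (x i) θ := by
  have h1 : HasFDerivAt (empLoss ρ x) ((n : ℝ)⁻¹ • ∑ i, fderiv ℝ (ρ (x i)) θ) θ :=
    (HasFDerivAt.fun_sum fun i _ => (hρ (x i) θ).hasFDerivAt).const_mul _
  unfold score gradient
  rw [h1.fderiv, map_smulₛₗ, map_sum]
  rfl

theorem hess_empLoss (hρ : ∀ y, Differentiable ℝ (ρ y))
    (hΨ : ∀ y, Differentiable ℝ (score ρ y)) (θ : Vec p) :
    hess (empLoss ρ x) θ = (n : ℝ)⁻¹ • ∑ i, scoreDot ρ (x i) θ := by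
  have h1 : HasFDerivAt (gradient (empLoss ρ x))
      ((n : ℝ)⁻¹ • ∑ i, fderiv ℝ (score ρ (x i)) θ) θ := by
    rw [funext (gradient_empLoss hρ)]
    exact (HasFDerivAt.fun_sum fun i _ => (hΨ (x i) θ).hasFDerivAt).const_smul (n : ℝ)⁻¹
  ext i j
  simp [hess, scoreDot, jacobian, h1.fderiv, Matrix.sum_apply]

theorem HessianCondition.isSymm (h : HessianCondition ρ x Bbar) (θ : Vec p) :
    (hess (empLoss ρ x) θ).IsSymm := by
  obtain ⟨a, -, ha⟩ := h.gram
  rw [ha, Matrix.IsSymm, Matrix.transpose_smul, Matrix.transpose_sum]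
  simp [Matrix.transpose_vecMulVec]

theorem HessianCondition.normSqMat_le (h : HessianCondition ρ x Bbar) (hn : 1 ≤ n)
    (θ u : Vec p) : normSqMat (hess (empLoss ρ x) θ) u ≤ Bbar * ‖u‖ ^ 2 := by
  obtain ⟨a, hB, ha⟩ := h.gram
  have hn' : (0 : ℝ) < n := by exact_mod_cast hn
  have h1 : normSqMat (hess (empLoss ρ x) θ) u =
      (n : ℝ)⁻¹ * ∑ i, (inner ℝ (a (x i) θ) u) ^ 2 := by
    rw [ha, normSqMat, Matrix.smul_mulVec, dotProduct_smul, Matrix.sum_mulVec, dotProduct_sum,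
      smul_eq_mul]
    congr 1
    refine Finset.sum_congr rfl fun i _ => ?_
    rw [Matrix.vecMulVec_mulVec, EuclideanSpace.inner_eq_star_dotProduct]
    simp only [star_trivial, op_smul_eq_smul, dotProduct_smul, smul_eq_mul]
    rw [dotProduct_comm (a (x i) θ).ofLp, sq]
  rw [h1, inv_mul_le_iff₀ hn']
  calc ∑ i, (inner ℝ (a (x i) θ) u) ^ 2 ≤ ∑ _i : Fin n, Bbar * ‖u‖ ^ 2 := by
        refine Finset.sum_le_sum fun i _ => ?_
        rw [← sq_abs]
        refine (pow_le_pow_left₀ (abs_nonneg _) (abs_real_inner_le_norm _ _) 2).trans ?_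
        rw [mul_pow]
        exact mul_le_mul_of_nonneg_right (hB _ _) (sq_nonneg _)
    _ = _ := by simp

/-- Hessian comparison with the center `θs` of the ball spreads positive definiteness to the whole
space. -/
theorem HessianCondition.normSqMat_pos (h : HessianCondition ρ x Bbar)
    (hsc : SelfConcordant γ 2 (empLoss ρ x)) (θ : Vec p) {u : Vec p} (hu : u ≠ 0) :
    0 < normSqMat (hess (empLoss ρ x) θ) u := by
  obtain ⟨θs, r, hr, hpd⟩ := h.posDef
  have h1 := (Matrix.posDef_iff_dotProduct_mulVec.1 (hpd θs (Metric.mem_ball_self hr))).2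
    (x := u.ofLp) (by simpa using hu)
  have h2 := hsc.exp_neg_mul_le_normSqMat_hess θs (θ - θs) u
  rw [add_sub_cancel] at h2
  refine lt_of_lt_of_le (mul_pos (Real.exp_pos _) ?_) h2
  simpa [normSqMat] using h1

theorem HessianCondition.lamMin_pos (h : HessianCondition ρ x Bbar) (hp : 1 ≤ p)
    (hsc : SelfConcordant γ 2 (empLoss ρ x)) (θ : Vec p) :
    0 < lamMin (hess (empLoss ρ x) θ) :=
  NoisyNewton.lamMin_pos hp (h.isSymm θ) fun _ hu => h.normSqMat_pos hsc θ hu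

theorem HessianCondition.tau1_mul_le (h : HessianCondition ρ x Bbar) (hp : 1 ≤ p)
    (hsc : SelfConcordant γ 2 (empLoss ρ x)) {θhat θ : Vec p} {R : ℝ}
    (hθ : θ ∈ Metric.closedBall θhat R) (u : Vec p) :
    tau1 (empLoss ρ x) θhat R * ‖u‖ ^ 2 ≤ normSqMat (hess (empLoss ρ x) θ) u := by
  refine le_trans (mul_le_mul_of_nonneg_right (csInf_le ?_ ⟨θ, hθ, rfl⟩) (sq_nonneg _))
    (lamMin_mul_le _ (h.isSymm θ) u)
  refine ⟨0, ?_⟩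
  rintro _ ⟨θ', -, rfl⟩
  exact (h.lamMin_pos hp hsc θ').le

theorem HessianCondition.tau1_pos (h : HessianCondition ρ x Bbar) (hp : 1 ≤ p) (hγ : 0 < γ)
    (hsc : SelfConcordant γ 2 (empLoss ρ x)) (θhat : Vec p) {R : ℝ} (hR : 0 ≤ R) :
    0 < tau1 (empLoss ρ x) θhat R := by
  have hl := h.lamMin_pos hp hsc θhat
  refine lt_of_lt_of_le (mul_pos (Real.exp_pos (-(γ * R))) hl)
    (le_csInf ⟨_, θhat, Metric.mem_closedBall_self hR, rfl⟩ ?_)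
  rintro _ ⟨θ, hθ, rfl⟩
  refine le_lamMin hp (h.isSymm θ) fun u => ?_
  have h1 := hsc.exp_neg_mul_le_normSqMat_hess θhat (θ - θhat) u
  rw [add_sub_cancel] at h1
  refine le_trans ?_ h1
  rw [mem_closedBall_iff_norm] at hθ
  rw [mul_assoc]
  refine mul_le_mul (Real.exp_le_exp.2 (neg_le_neg ?_)) (lamMin_mul_le _ (h.isSymm _) u)
    (by positivity) (Real.exp_pos _).le
  exact mul_le_mul_of_nonneg_left hθ hγ.le

end EmpiricalLoss

/-! ### Deterministic analysis of all iterates. -/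

section Iteration

variable {p : ℕ}

theorem mulV_inv_apply {A : Mat p} (hA : ∀ u, u ≠ 0 → 0 < normSqMat A u) (v : Vec p) :
    mulV A (mulV A⁻¹ v) = v := by
  have hinj : Function.Injective A.mulVec := by
    intro a b hab
    by_contra hne
    have h1 := hA (WithLp.toLp 2 (a - b)) (by simpa [sub_eq_zero] using hne)
    simp [normSqMat, Matrix.mulVec_sub, show A *ᵥ a = A *ᵥ b from hab] at h1
  have hdet := (Matrix.isUnit_iff_isUnit_det A).1 (Matrix.mulVec_injective_iff_isUnit.1 hinj)
  simp [mulV, Matrix.mulVec_mulVec, Matrix.mul_nonsing_inv A hdet]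

theorem normSqMat_add_pos {H E : Mat p} {τ : ℝ} (hτ : 0 < τ)
    (hH : ∀ u, τ * ‖u‖ ^ 2 ≤ normSqMat H u)
    (hE : ∀ u v, |inner ℝ u (mulV E v)| ≤ τ / 32 * ‖u‖ * ‖v‖) {u : Vec p} (hu : u ≠ 0) :
    0 < normSqMat (H + E) u := by
  have h1 := (abs_le.1 (hE u u)).1
  have h2 := hH u
  have h3 : 0 < τ * ‖u‖ ^ 2 := mul_pos hτ (pow_pos (norm_pos_iff.2 hu) 2)
  rw [normSqMat_eq_inner] at h2
  rw [normSqMat_eq_inner, mulV_add_left, inner_add_right]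
  linarith

theorem noise_scale_eq {p K n : ℕ} (b μ ξ : ℝ) :
    2 * b * Real.sqrt (2 * K) / (μ * n) *
      (60 * (Real.sqrt p * Real.sqrt (Real.log ((K : ℝ) * p / ξ)))) =
      120 * Real.sqrt 2 * b * (rate K p ξ / (μ * n)) := by
  rw [rate, mul_assoc (K : ℝ), Real.sqrt_mul (Nat.cast_nonneg K), Real.sqrt_mul (Nat.cast_nonneg p),
    Real.sqrt_mul (by norm_num)]
  ring

variable {𝒳 : Type*} {n K : ℕ} {ρ : 𝒳 → Vec p → ℝ} {x : Fin n → 𝒳} {γ B Bbar μ η ξ R τ r : ℝ}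
  {θhat θ0 : Vec p} {Z : ℕ → Vec p} {W : ℕ → Mat p}

/-- Deterministic analysis of the noisy damped Newton iterates when the noise is bounded. -/
theorem newtonIter_gap_le (hn : 1 ≤ n) (hp : 1 ≤ p) (hγ : 0 < γ) (hμ : 0 < μ)
    (hρ : ∀ y, Differentiable ℝ (ρ y)) (hΨ : ∀ y, Differentiable ℝ (score ρ y))
    (hB : 0 ≤ B) (hBbar : 0 < Bbar) (hsc : SelfConcordant γ 2 (empLoss ρ x))
    (hH : HessianCondition ρ x Bbar)
    (hmin : ∀ θ, empLoss ρ x θhat ≤ empLoss ρ x θ)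
    (hΔ : 0 < empLoss ρ x θ0 - empLoss ρ x θhat)
    (hR : γ⁻¹ * gInv (γ ^ 2 * (empLoss ρ x θ0 - empLoss ρ x θhat) /
      lamMin (hess (empLoss ρ x) θhat)) ≤ R) (hR0 : 0 ≤ R)
    (hτdef : τ = tau1 (empLoss ρ x) θhat R) (hτ : 0 < τ) (hτB : τ ≤ Bbar)
    (hη : 0 < η) (hηR : η ≤ 1 / (2 * Real.exp (2 * γ * R)))
    (hr : r = rate K p ξ / (μ * n)) (hr1 : 6000 * Bbar * r ≤ τ)
    (hr2 : 1000000 * B ^ 2 * Bbar * r ^ 2 ≤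
      τ ^ 2 * (empLoss ρ x θ0 - empLoss ρ x θhat))
    (hZ : ∀ k < K, ‖Z k‖ ≤ 60 * (Real.sqrt p * Real.sqrt (Real.log ((K : ℝ) * p / ξ))))
    (hW : ∀ k < K, ∀ u v, |inner ℝ u (mulV (W k) v)| ≤
      60 * (Real.sqrt p * Real.sqrt (Real.log ((K : ℝ) * p / ξ))) * ‖u‖ * ‖v‖) :
    empLoss ρ x (newtonIter ρ x B Bbar μ η K θ0 Z W K) - empLoss ρ x θhat ≤
      (1 - η / Real.exp (2 * γ * R)) ^ K * (empLoss ρ x θ0 - empLoss ρ x θhat)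
        + 1000000 * B ^ 2 * Bbar * r ^ 2 / τ ^ 2 := by
  set f := empLoss ρ x with hf
  set Δ := f θ0 - f θhat with hΔ_def
  set q := max (Real.exp (-(γ * R))) (τ / Bbar) with hq_def
  set ε := 120 * Real.sqrt 2 * B * r with hε_def
  have hγR : 0 ≤ γ * R := by positivity
  have hr0 : 0 ≤ r := by rw [hr, rate]; positivity
  have hq : 0 < q := lt_max_of_lt_left (Real.exp_pos _)
  have hq1 : q ≤ 1 := max_le (Real.exp_le_one_iff.2 (by linarith)) ((div_le_one hBbar).2 hτB)
  have hηexp : η * Real.exp (2 * γ * R) ≤ 1 / 2 := by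
    rw [le_div_iff₀ (by positivity)] at hηR
    linarith
  have hη1 : η ≤ 1 / 2 :=
    (le_mul_of_one_le_right hη.le (Real.one_le_exp (by linarith))).trans hηexp
  have hball : ∀ θ ∈ Metric.closedBall θhat R, ∀ u, τ * ‖u‖ ^ 2 ≤ normSqMat (hess f θ) u :=
    fun θ hθ u => hτdef ▸ hH.tau1_mul_le hp hsc hθ u
  have hgrad : gradient f θhat = 0 := by
    have : IsLocalMin f θhat := Filter.Eventually.of_forall hmin
    rw [gradient, this.fderiv_eq_zero, map_zero]
  have hlevel : ∀ θ, f θ - f θhat ≤ Δ → θ ∈ Metric.closedBall θhat R := fun θ hθ =>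
    hsc.mem_closedBall hγ hgrad (hH.isSymm _) (hH.lamMin_pos hp hsc _) hΔ hR hθ
  have hε2 : ε ^ 2 = 28800 * B ^ 2 * r ^ 2 := by
    rw [hε_def, mul_pow, mul_pow, mul_pow, Real.sq_sqrt (by norm_num)]; norm_num
  have hτq : τ / Bbar ≤ q := le_max_right _ _
  -- The constant `1000000` dominates `32 * 28800 = 921600`, where `28800 = 120² * 2`.
  have hεΔ : 32 * ε ^ 2 / τ ≤ q * Δ := by
    refine le_trans ?_ (mul_le_mul_of_nonneg_right hτq hΔ.le)
    rw [hε2, div_mul_eq_mul_div, div_le_div_iff₀ hτ hBbar]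
    have : 0 ≤ B ^ 2 * Bbar * r ^ 2 := by positivity
    linarith
  have hsqrt2 : Real.sqrt 2 ≤ 3 / 2 := by
    rw [Real.sqrt_le_left (by norm_num)]; norm_num
  have hstep : ∀ k < K, f (newtonIter ρ x B Bbar μ η K θ0 Z W k) - f θhat ≤ Δ →
      f (newtonIter ρ x B Bbar μ η K θ0 Z W (k + 1)) - f θhat ≤ Δ ∧
      f (newtonIter ρ x B Bbar μ η K θ0 Z W (k + 1)) - f θhat ≤
        (1 - η * q) * (f (newtonIter ρ x B Bbar μ η K θ0 Z W k) - f θhat)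
          + η * (32 * ε ^ 2 / τ) := by
    intro k hk hθ
    rw [newtonIter]
    set θ := newtonIter ρ x B Bbar μ η K θ0 Z W k
    have hE : ∀ u v, |inner ℝ u (mulV ((2 * Bbar * Real.sqrt (2 * K) / (μ * n)) • W k) v)| ≤
        τ / 32 * ‖u‖ * ‖v‖ := by
      intro u v
      have hσ : 0 ≤ 2 * Bbar * Real.sqrt (2 * K) / (μ * n) := by positivity
      rw [mulV_smul_left, inner_smul_right, abs_mul, abs_of_nonneg hσ]
      refine (mul_le_mul_of_nonneg_left (hW k hk u v) hσ).trans ?_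
      rw [← mul_assoc, ← mul_assoc, noise_scale_eq, ← hr]
      -- Here `32 * 120 * 3/2 = 5760 ≤ 6000`, the constant in `hr1`.
      have h1 : 120 * Real.sqrt 2 * Bbar * r ≤ τ / 32 := by
        have := mul_le_mul_of_nonneg_right hsqrt2 (by positivity : 0 ≤ Bbar * r)
        have : 0 ≤ Bbar * r := by positivity
        linarith
      gcongr
    have he : ‖(2 * B * Real.sqrt (2 * K) / (μ * n)) • Z k‖ ≤ ε := by
      have hσ : 0 ≤ 2 * B * Real.sqrt (2 * K) / (μ * n) := by positivity
      rw [norm_smul, Real.norm_of_nonneg hσ]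
      refine (mul_le_mul_of_nonneg_left (hZ k hk) hσ).trans ?_
      rw [noise_scale_eq, ← hr]
    refine noisy_newton_step hsc hγ hBbar hτ hτB hR0 hH.isSymm hball
      (hH.normSqMat_le hn) hlevel hθ hE he hεΔ ?_ hη hηR
    have hnh : noisyHess ρ x Bbar μ K (W k) θ =
        hess f θ + (2 * Bbar * Real.sqrt (2 * K) / (μ * n)) • W k := by
      rw [noisyHess, hf, hess_empLoss hρ hΨ]
    have hng : noisyGrad ρ x B μ K (Z k) θ =
        gradient f θ + (2 * B * Real.sqrt (2 * K) / (μ * n)) • Z k := by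
      rw [noisyGrad, hf, gradient_empLoss hρ]
    rw [hnh, hng]
    exact mulV_inv_apply (fun u hu => normSqMat_add_pos hτ (hball θ (hlevel θ hθ)) hE hu) _
  have hstay : ∀ k ≤ K, f (newtonIter ρ x B Bbar μ η K θ0 Z W k) - f θhat ≤ Δ := by
    intro k
    induction k with
    | zero => intro _; exact le_rfl
    | succ k ih => intro hk; exact (hstep k (by omega) (ih (by omega))).1
  have hηq : η * q ≤ 1 := by nlinarith
  have hrec := le_of_linear_recursion
    (a := fun k => f (newtonIter ρ x B Bbar μ η K θ0 Z W k) - f θhat)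
    (δ := 32 * ε ^ 2 / τ / q) hηq (by positivity) (K := K)
    (fun k hk => by
      refine ((hstep k hk (hstay k hk.le)).2).trans (le_of_eq ?_)
      field_simp)
  refine hrec.trans (add_le_add (mul_le_mul_of_nonneg_right ?_ hΔ.le) ?_)
  -- The contraction uses `q ≥ exp (-γ R) ≥ exp (-2 γ R)`; the noise term below uses `q ≥ τ / Bbar`.
  · refine pow_le_pow_left₀ (by linarith) (sub_le_sub_left ?_ 1) K
    rw [div_eq_mul_inv, ← Real.exp_neg]
    refine mul_le_mul_of_nonneg_left (le_trans ?_ (le_max_left _ _)) hη.le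
    exact Real.exp_le_exp.2 (by linarith)
  · calc 32 * ε ^ 2 / τ / q ≤ 32 * ε ^ 2 / τ / (τ / Bbar) := by gcongr
      _ = 921600 * B ^ 2 * Bbar * r ^ 2 / τ ^ 2 := by rw [hε2]; field_simp; ring
      _ ≤ _ := by gcongr; norm_num

end Iteration

end NoisyNewton

/-! ### The main theorem. -/

open NoisyNewton in
theorem proposition3p2 :
    -- `C'` depends only on `τ_{1,R0}`, `B`, `Bbar`; the constant `c` in the sample size
    -- condition depends only on these and on the initial gap `Δ0`.
    ∃ (C' : ℝ → ℝ → ℝ → ℝ) (c : ℝ → ℝ → ℝ → ℝ → ℝ),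
      (∀ t b b', 0 < C' t b b') ∧ (∀ t b b' d, 0 < c t b b' d) ∧
      ∀ (𝒳 : Type*) (Ω : Type*) [MeasurableSpace Ω] (P : Measure Ω) [IsProbabilityMeasure P]
        (n p K : ℕ) (ρ : 𝒳 → Vec p → ℝ) (x : Fin n → 𝒳)
        (γ B Bbar μ η ξ R0 : ℝ) (θhat θ0 : Vec p)
        (Z : ℕ → Ω → Vec p) (W : ℕ → Ω → Mat p),
        1 ≤ n → 1 ≤ p → 1 ≤ K → 0 < γ → 0 < μ → 0 < ξ → ξ < 1 →
        -- the loss function is twice differentiable in the parameter, with score bounded by `B`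
        (∀ y, Differentiable ℝ (ρ y)) →
        (∀ y, Differentiable ℝ (score ρ y)) →
        (∀ y θ, ‖score ρ y θ‖ ≤ B) →
        -- assumptions on the empirical loss
        SelfConcordant γ 2 (empLoss ρ x) →
        HessianCondition ρ x Bbar →
        (∀ θ, empLoss ρ x θhat ≤ empLoss ρ x θ) →
        0 < empLoss ρ x θ0 - empLoss ρ x θhat →
        -- the radius `R0`
        γ⁻¹ * gInv (γ ^ 2 * (empLoss ρ x θ0 - empLoss ρ x θhat) /
            lamMin (hess (empLoss ρ x) θhat)) ≤ R0 →
        -- the stepsize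
        0 < η →
        η ≤ min (1 / (2 * Real.exp (2 * γ * R0)))
            (4 * tau1 (empLoss ρ x) θhat R0 ^ 2 / Bbar ^ 2) →
        -- the sample size
        c (tau1 (empLoss ρ x) θhat R0) B Bbar (empLoss ρ x θ0 - empLoss ρ x θhat) *
            (rate K p ξ / μ) ≤ (n : ℝ) →
        IsNewtonNoise P K Z W →
        1 - ξ ≤ P.real {ω |
          empLoss ρ x (newtonIter ρ x B Bbar μ η K θ0 (fun k => Z k ω) (fun k => W k ω) K)
              - empLoss ρ x θhat ≤
            (1 - η / Real.exp (2 * γ * R0)) ^ K * (empLoss ρ x θ0 - empLoss ρ x θhat)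
              + C' (tau1 (empLoss ρ x) θhat R0) B Bbar *
                (rate K p ξ / (μ * n * tau1 (empLoss ρ x) θhat R0 ^ 2))} := by
  -- The three summands of `c` yield `r ≤ 1`, `hr1` and `hr2` respectively. Absolute values and the
  -- added `1` make both functions positive for all real arguments.
  refine ⟨fun _ b b' => 1000000 * b ^ 2 * |b'| + 1,
    fun t b b' d => 1 + |6000 * b' / t| + |1000000 * b ^ 2 * b' / (t ^ 2 * d)|,
    fun _ _ _ => by positivity, fun _ _ _ _ => by positivity, ?_⟩
  intro 𝒳 Ω _ P _ n p K ρ x γ B Bbar μ η ξ R0 θhat θ0 Z W hn hp hK hγ hμ hξ hξ1 hρ hΨ hB hsc hH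
    hmin hΔ hR hη hηle hsize hnoise
  set τ := tau1 (empLoss ρ x) θhat R0 with hτ_def
  set Δ := empLoss ρ x θ0 - empLoss ρ x θhat with hΔ_def
  have hB0 : 0 ≤ B := (norm_nonneg _).trans (hB (x ⟨0, hn⟩) 0)
  have hlam := hH.lamMin_pos hp hsc θhat
  have hR0 : 0 ≤ R0 := by
    refine le_trans (mul_nonneg (inv_nonneg.2 hγ.le) (gInv_pos ?_).le) hR
    positivity
  have hτ : 0 < τ := hH.tau1_pos hp hγ hsc θhat hR0
  have hτB : τ ≤ Bbar := by
    have h1 := hH.tau1_mul_le hp hsc (Metric.mem_closedBall_self hR0 : θhat ∈ _)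
      (EuclideanSpace.single (⟨0, hp⟩ : Fin p) (1 : ℝ))
    have h2 := h1.trans (hH.normSqMat_le hn _ _)
    simpa using h2
  have hBbar : 0 < Bbar := hτ.trans_le hτB
  have hn' : (0 : ℝ) < n := by exact_mod_cast hn
  set r := rate K p ξ / (μ * n) with hr_def
  have hr0 : 0 ≤ r := by rw [hr_def, rate]; positivity
  have hcr : (1 + |6000 * Bbar / τ| + |1000000 * B ^ 2 * Bbar / (τ ^ 2 * Δ)|) * r ≤ 1 := by
    rw [hr_def, ← div_div (rate K p ξ), ← mul_div_assoc, div_le_one hn']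
    exact hsize
  rw [abs_of_nonneg (by positivity), abs_of_nonneg (by positivity)] at hcr
  have h1 : 0 ≤ 6000 * Bbar / τ * r := by positivity
  have h2 : 0 ≤ 1000000 * B ^ 2 * Bbar / (τ ^ 2 * Δ) * r := by positivity
  have hr_le : r ≤ 1 := by linarith
  have hr1 : 6000 * Bbar * r ≤ τ := by
    have h3 : 6000 * Bbar / τ * r ≤ 1 := by linarith
    rwa [div_mul_eq_mul_div, div_le_one hτ] at h3
  -- The deterministic bound is of order `r²`; `r ≤ 1` turns it into the stated order `r`, and
  -- likewise lets a condition linear in `r` imply `hr2`.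
  have hrsq : r ^ 2 ≤ r := by nlinarith
  have hr2 : 1000000 * B ^ 2 * Bbar * r ^ 2 ≤ τ ^ 2 * Δ := by
    have h3 : 1000000 * B ^ 2 * Bbar / (τ ^ 2 * Δ) * r ≤ 1 := by linarith
    rw [div_mul_eq_mul_div, div_le_one (by positivity)] at h3
    exact (mul_le_mul_of_nonneg_left hrsq (by positivity)).trans h3
  refine (hnoise.noiseBounded_prob hp hK hξ hξ1).trans (measureReal_mono fun ω hω => ?_)
  refine (newtonIter_gap_le hn hp hγ hμ hρ hΨ hB0 hBbar hsc hH hmin hΔ hR hR0 hτ_def hτ hτB hη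
    (hηle.trans (min_le_left _ _)) hr_def hr1 hr2 (fun k hk => (hω k hk).1)
    (fun k hk => (hω k hk).2)).trans (add_le_add le_rfl ?_)
  beta_reduce
  rw [← div_div (rate K p ξ), ← mul_div_assoc, abs_of_pos hBbar]
  refine div_le_div_of_nonneg_right ?_ (sq_nonneg τ)
  have h3 := mul_le_mul_of_nonneg_left hrsq (by positivity : 0 ≤ 1000000 * B ^ 2 * Bbar)
  linarith
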